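/- Let $\lambda>0$ and $n\ge 2$. Let $\mathbb A^{(\lambda)}(\mathbb D^n)$ be the Hilbert space of holomorphic functions on the polydisc $\mathbb D^n$ with reproducing kernel $K^{(\lambda)}(z,w)=\prod_{j=1}^n(1-z_j\bar w_j)^{-\lambda}$. For $\sigma\in\mathfrak S_n$ put $\sigma\cdot z=(z_{\sigma^{-1}(1)},\dots,z_{\sigma^{-1}(n)})$ and $(f\circ\sigma^{-1})(z)=f(\sigma^{-1}\cdot z)$. Let $\mathbb A^{(\lambda)}_{\rm sym}(\mathbb D^n)$ and $\mathbb A^{(\lambda)}_{\rm anti}(\mathbb D^n)$ be the closed subspaces of those $f\in\mathbb A^{(\lambda)}(\mathbb D^n)$ with $f\circ\sigma^{-1}=f$, respectively $f\circ\sigma^{-1}={\rm sgn}(\sigma)f$, for all $\sigma\in\mathfrak S_n$; these are the ranges of the projections $\mathbb P_{(n)}$ and $\mathbb P_{(1^n)}$. They are Hilbert modules over the ring $\mathbb C[z]^{\mathfrak S_n}$ of symmetric polynomials, which acts by pointwise multiplication. Two Hilbert modules $H,H'$ over $\mathbb C[z]^{\mathfrak S_n}$ are (unitarily) equivalent if there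 is a unitary $U:H\to H'$ with $U(p\cdot h)=p\cdot U(h)$ for all $p\in\mathbb C[z]^{\mathfrak S_n}$ and $h\in H$. Let $s=(s_1,\dots,s_n)$ be the map given by the elementary symmetric functions, $\mathbb G_n=s(\mathbb D^n)$ the symmetrized polydisc and $J_s(z)=\prod_{i<j}(z_i-z_j)$. A symmetric polynomial $p=q(s_1,\dots,s_n)$ acts on functions on $\mathbb G_n$ by multiplication with $q$. Let $\mathcal H^{(\lambda)}(\mathbb G_n)$ be the Hilbert module of holomorphic $g:\mathbb G_n\to\mathbb C$ with $g\circ s\in\mathbb A^{(\lambda)}(\mathbb D^n)$, with $\langle g_1,g_2\rangle=\langle g_1\circ s,g_2\circ s\rangle$. Let the weighted Bergman module $\mathbb A^{(\lambda)}(\mathbb G_n)$ be the Hilbert module of holomorphic $g:\mathbb G_n\to\mathbb C$ with $J_s\cdot(g\circ s)\in\mathbb A^{(\lambda)}(\mathbb D^n)$, with $\langle g_1,g_2\rangle=\frac1{n!}\langle J_s\cdot(g_1\circ s),J_s\cdot(g_2\circ s)\rangle$. For $\lambda>1$ let $\mathbb A^{(\lambda)}_{L^2}(\mathbb G_n)$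 be the subspace of holomorphic functions in $L^2(\mathbb G_n,dV_s^{(\lambda)})$, where $\int_{\mathbb G_n} f\,dV_s^{(\lambda)}=\frac1{n!}\int_{\mathbb D^n}(f\circ s)\,|J_s|^2\,dV^{(\lambda)}$ and $dV^{(\lambda)}(z)=\prod_{i=1}^n\frac{\lambda-1}{\pi}(1-|z_i|^2)^{\lambda-2}\,dA(z_i)$, with $dA$ the Lebesgue measure on $\mathbb C$. Then: 1. the Hilbert modules $\mathbb A^{(\lambda)}_{\rm sym}(\mathbb D^n)$ and $\mathbb A^{(\lambda)}_{\rm anti}(\mathbb D^n)$ over $\mathbb C[z]^{\mathfrak S_n}$ are not equivalent; 2. the Hilbert modules $\mathbb A^{(\lambda)}(\mathbb G_n)$ and $\mathcal H^{(\lambda)}(\mathbb G_n)$ over $\mathbb C[z]^{\mathfrak S_n}$ are not equivalent; and for $\lambda>1$ neither are $\mathbb A^{(\lambda)}_{L^2}(\mathbb G_n)$ and $\mathcal H^{(\lambda)}(\mathbb G_n)$. -/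

import Mathlib

open scoped ComplexConjugate InnerProductSpace

noncomputable section

/-- The open unit polydisc `𝔻ⁿ` in `ℂⁿ`. -/
def polydisc (n : ℕ) : Set (Fin n → ℂ) := {z | ∀ i, ‖z i‖ < 1}

/-- The kernel `(z, w) ↦ ∏ⱼ fⱼ(zⱼ w̄ⱼ)` on the polydisc. -/
def productKernel {n : ℕ} (f : Fin n → ℂ → ℂ) : Matrix (polydisc n) (polydisc n) (ℂ →L[ℂ] ℂ) :=
  .of fun z w => (∏ j, f j (z.1 j * conj (w.1 j))) • ContinuousLinearMap.id ℂ ℂ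

theorem norm_mul_conj_lt_one {n : ℕ} (z w : polydisc n) (j : Fin n) :
    ‖z.1 j * conj (w.1 j)‖ < 1 := by
  have h1 := z.2 j
  have h2 := w.2 j
  rw [norm_mul, RCLike.norm_conj]
  calc _ ≤ ‖z.1 j‖ * 1 := by gcongr
    _ < 1 := by simpa using h1

theorem posSemidef_productKernel {n : ℕ} (f : Fin n → ℂ → ℂ) (a : Fin n → ℕ → ℝ)
    (ha : ∀ j k, 0 ≤ a j k)
    (hf : ∀ j t, ‖t‖ < 1 → HasSum (fun k => (a j k : ℂ) * t ^ k) (f j t)) :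
    (productKernel f).PosSemidef := by
  refine ((RKHS.posSemidef_tfae (K := productKernel f)).out 0 2).2 ?_
  have hconj : ∀ j t, ‖t‖ < 1 → conj (f j t) = f j (conj t) := by
    intro j t ht
    have h1 := (hf j t ht).map (starRingEnd ℂ) Complex.continuous_conj
    have h2 := hf j (conj t) (by simpa using ht)
    refine h1.unique (h2.congr_fun ?_)
    intro k; simp
  refine ⟨?_, ?_⟩
  · ext z w
    simp only [Matrix.conjTranspose_apply, productKernel, Matrix.of_apply, star_smul, star_prod,
      RCLike.star_def, ContinuousLinearMap.star_eq_adjoint, ContinuousLinearMap.adjoint_id]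
    simp_rw [fun j => hconj j _ (norm_mul_conj_lt_one w z j)]
    simp [mul_comm]
  · intro c
    have hlim : Filter.Tendsto (fun N : ℕ => RCLike.re (K := ℂ) (c.sum fun x w => c.sum fun x' w' =>
        (∏ j, ∑ k ∈ Finset.range N, (a j k : ℂ) * (x.1 j * conj (x'.1 j)) ^ k) * (conj w * w')))
        Filter.atTop (nhds (RCLike.re (c.sum fun x w => c.sum fun x' w' =>
          ⟪productKernel f x' x w, w'⟫_ℂ))) := by
      refine (RCLike.continuous_re.tendsto _).comp ?_
      refine tendsto_finsetSum _ fun x _ => tendsto_finsetSum _ fun x' _ => ?_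
      have : ⟪productKernel f x' x (c x), c x'⟫_ℂ =
          (∏ j, f j (x.1 j * conj (x'.1 j))) * (conj (c x) * c x') := by
        simp only [productKernel, Matrix.of_apply]
        simp [map_prod]
        simp_rw [fun j => hconj j _ (norm_mul_conj_lt_one x' x j)]
        simp [mul_comm, mul_left_comm]
      refine Eq.subst (motive := fun l => Filter.Tendsto _ Filter.atTop (nhds l)) this.symm ?_
      refine Filter.Tendsto.mul_const _ (tendsto_finsetProd _ fun j _ => ?_)
      exact (hf j _ (norm_mul_conj_lt_one x x' j)).tendsto_sum_nat
    refine ge_of_tendsto' hlim fun N => ?_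
    have : (c.sum fun x w => c.sum fun x' w' =>
        (∏ j, ∑ k ∈ Finset.range N, (a j k : ℂ) * (x.1 j * conj (x'.1 j)) ^ k) * (conj w * w')) =
        ((∑ m ∈ Fintype.piFinset (fun _ : Fin n => Finset.range N), (∏ j, a j (m j)) *
          ‖∑ x ∈ c.support, conj (c x) * ∏ j, x.1 j ^ m j‖ ^ 2 : ℝ) : ℂ) := by
      push_cast
      simp_rw [← Complex.mul_conj', Finsupp.sum, Finset.prod_univ_sum, map_sum, Finset.sum_mul_sum,
        Finset.sum_mul, Finset.mul_sum]
      rw [Finset.sum_comm_cycle]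
      refine Finset.sum_congr rfl fun m _ => Finset.sum_congr rfl fun x _ =>
        Finset.sum_congr rfl fun x' _ => ?_
      simp only [mul_pow, Finset.prod_mul_distrib, map_mul, map_prod, map_pow, Complex.conj_conj]
      ring
    rw [this]
    simp only [RCLike.re_to_complex, Complex.ofReal_re]
    exact Finset.sum_nonneg fun m _ => mul_nonneg (Finset.prod_nonneg fun j _ => ha _ _) (sq_nonneg _)

section multiplier
variable {X H : Type*} [NormedAddCommGroup H] [InnerProductSpace ℂ H] [CompleteSpace H]
  [RKHS ℂ H X ℂ]

theorem exists_multiplication (φ : X → ℂ) (C : ℝ) (hC : 0 ≤ C)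
    (h : ∀ c : X →₀ ℂ, 0 ≤ RCLike.re (c.sum fun x w => c.sum fun x' w' =>
      conj (((C : ℂ) ^ 2 - φ x' * conj (φ x)) * RKHS.kernel H x' x w) * w')) :
    ∃ T : H →L[ℂ] H, ∀ (f : H) (x : X), T f x = φ x * f x := by
  let k : X → H := fun x => RKHS.kerFun H x 1
  let e : (X →₀ ℂ) →ₗ[ℂ] H := Finsupp.linearCombination ℂ k
  let g : (X →₀ ℂ) →ₗ[ℂ] H := Finsupp.linearCombination ℂ (fun x => conj (φ x) • k x)
  have hk : ∀ x v, RKHS.kerFun H x v = v • k x := fun x v => by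
    simp only [k]; rw [← map_smul]; simp
  have hdense : DenseRange e := by
    have := RKHS.kerFun_dense (𝕜 := ℂ) (X := X) (V := ℂ) H
    rw [← Submodule.dense_iff_topologicalClosure_eq_top] at this
    refine this.mono ?_
    rw [← LinearMap.coe_range]
    simp only [SetLike.coe_subset_coe]
    refine Submodule.span_le.2 ?_
    rintro _ ⟨x, v, rfl⟩
    exact ⟨Finsupp.single x v, by simp [e, hk]⟩
  have hnorm : ∀ c, ‖g c‖ ≤ C * ‖e c‖ := by
    intro c
    refine (sq_le_sq₀ (norm_nonneg _) (by positivity)).1 ?_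
    have h1 := h c
    have hkk : ∀ x x', ⟪k x, k x'⟫_ℂ = RKHS.kernel H x x' 1 := fun x x' => by
      simp only [k, RKHS.kerFun_inner, RKHS.kerFun_apply]; simp
    have hconj : ∀ x x', conj (RKHS.kernel H x' x 1) = ⟪k x, k x'⟫_ℂ := fun x x' => by
      rw [← hkk x' x, inner_conj_symm]
    have hk1 : ∀ x x' (w : ℂ), RKHS.kernel H x' x w = w * RKHS.kernel H x' x 1 := fun x x' w => by
      rw [← smul_eq_mul, ← map_smul]; simp
    have h2 : (c.sum fun x w => c.sum fun x' w' =>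
        conj (((C : ℂ) ^ 2 - φ x' * conj (φ x)) * RKHS.kernel H x' x w) * w') =
        (C : ℂ) ^ 2 * ⟪e c, e c⟫_ℂ - ⟪g c, g c⟫_ℂ := by
      simp only [e, g, Finsupp.linearCombination_apply, Finsupp.sum, Finset.mul_sum, inner_smul_left, inner_smul_right, sum_inner, inner_sum]
      rw [Finset.sum_comm, ← Finset.sum_sub_distrib]
      refine Finset.sum_congr rfl fun x _ => ?_
      rw [← Finset.sum_sub_distrib]
      refine Finset.sum_congr rfl fun x' _ => ?_
      rw [hk1, map_mul, map_mul, hconj]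
      simp
      ring
    rw [h2, inner_self_eq_norm_sq_to_K, inner_self_eq_norm_sq_to_K] at h1
    have h3 : RCLike.re ((C : ℂ) ^ 2 * ((‖e c‖ : ℝ) : ℂ) ^ 2 - ((‖g c‖ : ℝ) : ℂ) ^ 2) =
        (C * ‖e c‖) ^ 2 - ‖g c‖ ^ 2 := by
      rw [← Complex.ofReal_pow, ← Complex.ofReal_pow, ← Complex.ofReal_pow, ← Complex.ofReal_mul,
        ← Complex.ofReal_sub, RCLike.re_to_complex, Complex.ofReal_re, mul_pow]
    have h4 := h3 ▸ h1
    linarith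
  let S : H →L[ℂ] H := g.extendOfNorm e
  have hS : ∀ x, S (k x) = conj (φ x) • k x := by
    intro x
    have := LinearMap.extendOfNorm_eq (f := g) hdense ⟨C, hnorm⟩ (Finsupp.single x 1)
    simpa [e, g, S] using this
  refine ⟨ContinuousLinearMap.adjoint S, fun f x => ?_⟩
  have key : ∀ f : H, f x = ⟪k x, f⟫_ℂ := fun f => by simp [k]
  rw [key, ContinuousLinearMap.adjoint_inner_right, hS, inner_smul_left, ← key]
  simp
end multiplier

/-- The reproducing kernel `K^(λ)(z, w) = ∏ⱼ (1 - zⱼ w̄ⱼ)^(-λ)` of the polydisc (principal powers),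
with `ℂ`-valued entries read as operators on `ℂ`. -/
def bergmanKernel (n : ℕ) (lam : ℝ) : Matrix (polydisc n) (polydisc n) (ℂ →L[ℂ] ℂ) :=
  .of fun z w => (∏ j, (1 - z.1 j * conj (w.1 j)) ^ (-(lam : ℂ))) • ContinuousLinearMap.id ℂ ℂ

/-- The Taylor coefficients `(λ)ₖ / k!` of `(1 - t)^(-λ)`. -/
def binomCoeff (lam : ℝ) (k : ℕ) : ℝ := Ring.choose (lam + k - 1) k

theorem binomCoeff_succ (lam : ℝ) (k : ℕ) :
    (k + 1) * binomCoeff lam (k + 1) = (lam + k) * binomCoeff lam k := by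
  have h : ∀ m, (Nat.factorial m : ℝ) * binomCoeff lam m = (ascPochhammer ℝ m).eval lam := by
    intro m
    rw [binomCoeff, ← Ring.multichoose_eq, ← nsmul_eq_mul,
      Ring.factorial_nsmul_multichoose_eq_ascPochhammer, Polynomial.ascPochhammer_smeval_eq_eval]
  have h1 := h (k + 1)
  rw [ascPochhammer_succ_eval, ← h k, Nat.factorial_succ] at h1
  have h2 : (Nat.factorial k : ℝ) ≠ 0 := by positivity
  push_cast at h1
  apply mul_left_cancel₀ h2
  linarith

theorem binomCoeff_pos {lam : ℝ} (hl : 0 < lam) (k : ℕ) : 0 < binomCoeff lam k := by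
  induction k with
  | zero => simp [binomCoeff]
  | succ k ih =>
    have h := binomCoeff_succ lam k
    have h1 : 0 < (lam + k) * binomCoeff lam k := by positivity
    rw [← h] at h1
    exact pos_of_mul_pos_right h1 (by positivity)

theorem hasSum_binomCoeff (lam : ℝ) (t : ℂ) (ht : ‖t‖ < 1) :
    HasSum (fun k => (binomCoeff lam k : ℂ) * t ^ k) ((1 - t) ^ (-(lam : ℂ))) := by
  have h := (Complex.one_div_one_sub_cpow_hasFPowerSeriesOnBall_zero (lam : ℂ)).hasSum
    (y := t) (by simpa [enorm_eq_nnnorm] using! ht)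
  rw [zero_add, one_div, ← Complex.cpow_neg] at h
  refine h.congr_fun fun k => ?_
  simp [binomCoeff, Complex.ofReal_choose, mul_comm]

theorem posSemidef_bergmanKernel (n : ℕ) {lam : ℝ} (hl : 0 < lam) :
    (bergmanKernel n lam).PosSemidef :=
  posSemidef_productKernel (fun _ t => (1 - t) ^ (-(lam : ℂ))) (fun _ => binomCoeff lam)
    (fun _ k => (binomCoeff_pos hl k).le) (fun _ t ht => hasSum_binomCoeff lam t ht)

instance factPosSemidefBergmanKernel (n : ℕ) (lam : ℝ) [h : Fact (0 < lam)] :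
    Fact (bergmanKernel n lam).PosSemidef :=
  ⟨posSemidef_bergmanKernel n h.out⟩

/-- The Hilbert space `𝔸^(λ)(𝔻ⁿ)` of functions on the polydisc with reproducing kernel `K^(λ)`. -/
abbrev BergmanSpace (n : ℕ) (lam : ℝ) [Fact (0 < lam)] : Type :=
  RKHS.OfKernel (bergmanKernel n lam)

theorem BergmanSpace.exists_coord_mul (n : ℕ) (lam : ℝ) [hl : Fact (0 < lam)] (i : Fin n) :
    ∃ T : BergmanSpace n lam →L[ℂ] BergmanSpace n lam,
      ∀ (f : BergmanSpace n lam) (z : polydisc n), T f z = z.1 i * f z := by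
  have hl0 := hl.out
  obtain ⟨C, hC0, hC⟩ : ∃ C : ℝ, 0 ≤ C ∧ 1 ≤ C ^ 2 ∧ 1 ≤ C ^ 2 * lam := by
    refine ⟨1 + lam⁻¹, by positivity, ?_, ?_⟩
    · have : 0 < lam⁻¹ := by positivity
      nlinarith
    · have : lam⁻¹ * lam = 1 := inv_mul_cancel₀ hl0.ne'
      have h2 : 0 < lam⁻¹ := by positivity
      nlinarith [mul_pos hl0 h2]
  let F : Fin n → ℂ → ℂ := fun _ t => (1 - t) ^ (-(lam : ℂ))
  let F' : Fin n → ℂ → ℂ := Function.update F i (fun t => ((C : ℂ) ^ 2 - t) * F i t)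
  let b : ℕ → ℝ := fun k => C ^ 2 * binomCoeff lam k - Nat.casesOn k 0 (binomCoeff lam)
  let a : Fin n → ℕ → ℝ := Function.update (fun _ => binomCoeff lam) i b
  have hb : ∀ k, 0 ≤ b k := by
    rintro (_ | k)
    · simp only [b]
      have := binomCoeff_pos hl0 0
      simp; positivity
    · simp only [b]
      have h1 := binomCoeff_succ lam k
      have h2 := binomCoeff_pos hl0 k
      have h3 : ((k : ℝ) + 1) * binomCoeff lam k ≤ (k + 1) * (C ^ 2 * binomCoeff lam (k + 1)) := by
        have : (k : ℝ) + 1 ≤ C ^ 2 * (lam + k) := by nlinarith [hC.1, hC.2, (Nat.cast_nonneg k : (0:ℝ) ≤ k)]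
        calc _ ≤ C ^ 2 * (lam + k) * binomCoeff lam k := by gcongr
          _ = _ := by rw [mul_assoc, ← h1]; ring
      have := le_of_mul_le_mul_left h3 (by positivity)
      linarith
  have hbs : ∀ t : ℂ, ‖t‖ < 1 → HasSum (fun k => (b k : ℂ) * t ^ k) (((C : ℂ) ^ 2 - t) * F i t) := by
    intro t ht
    have h1 := (hasSum_binomCoeff lam t ht)
    have h2 : HasSum (fun k : ℕ => ((Nat.casesOn k 0 (binomCoeff lam) : ℝ) : ℂ) * t ^ k)
        (t * F i t) := by
      rw [← hasSum_nat_add_iff' 1]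
      have h0 : t * F i t - ∑ k ∈ Finset.range 1,
          ((Nat.casesOn k 0 (binomCoeff lam) : ℝ) : ℂ) * t ^ k = t * (1 - t) ^ (-(lam : ℂ)) := by
        simp [F]
      rw [h0]
      refine (h1.mul_left t).congr_fun fun k => ?_
      ring
    rw [sub_mul]
    refine ((h1.mul_left ((C : ℂ) ^ 2)).sub h2).congr_fun fun k => ?_
    simp [b]
    ring
  have hpsd : (productKernel F').PosSemidef := by
    refine posSemidef_productKernel F' a (fun j k => ?_) (fun j t ht => ?_)
    · rcases eq_or_ne j i with rfl | hj
      · simpa [a] using hb k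
      · simpa [a, hj] using (binomCoeff_pos hl0 k).le
    · rcases eq_or_ne j i with rfl | hj
      · simpa [a, F'] using hbs t ht
      · simpa [a, F', hj, F] using hasSum_binomCoeff lam t ht
  have hpsd' : (productKernel F').IsHermitian ∧ ∀ v : polydisc n →₀ ℂ, 0 ≤ RCLike.re
      (v.sum fun x w => v.sum fun x' w' => ⟪productKernel F' x' x w, w'⟫_ℂ) :=
    ((RKHS.posSemidef_tfae (K := productKernel F')).out 0 2).1 hpsd
  have hform := hpsd'.2
  refine exists_multiplication (fun z : polydisc n => z.1 i) C hC0 fun c => ?_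
  refine (hform c).trans_eq ?_
  congr 1
  refine Finset.sum_congr rfl fun x _ => Finset.sum_congr rfl fun x' _ => ?_
  simp only [RKHS.OfKernel.kernel_ofKernel]
  have : productKernel F' x' x = ((C : ℂ) ^ 2 - x'.1 i * conj (x.1 i)) • bergmanKernel n lam x' x := by
    simp only [productKernel, bergmanKernel, Matrix.of_apply, smul_smul]
    congr 1
    rw [← Finset.mul_prod_erase _ _ (Finset.mem_univ i), ← Finset.mul_prod_erase _ _ (Finset.mem_univ i),
      ← mul_assoc]
    congr 1
    · simp [F', F]
    · refine Finset.prod_congr rfl fun j hj => ?_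
      simp [F', F, Finset.ne_of_mem_erase hj]
  have h2 : productKernel F' x' x (c x) =
      ((C : ℂ) ^ 2 - x'.1 i * conj (x.1 i)) * bergmanKernel n lam x' x (c x) := by
    rw [this]; rfl
  refine Eq.trans (congrArg (fun v => ⟪v, c x'⟫_ℂ) h2) ?_
  rw [RCLike.inner_apply, mul_comm]


section action
variable {R H : Type*} [CommRing R] [Algebra ℂ R] [NormedAddCommGroup H] [InnerProductSpace ℂ H]

/-- An action of a `ℂ`-algebra `R` on `H` by bounded operators, assembled from a property `P r T`
("`T` is multiplication by `r`") that singles out one bounded operator for every `r`. -/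
def actionOfSpec (P : R → (H →L[ℂ] H) → Prop) (ex : ∀ r, ∃ T, P r T)
    (uniq : ∀ r S T, P r S → P r T → S = T)
    (mul : ∀ r s S T, P r S → P s T → P (r * s) (S * T))
    (add : ∀ r s S T, P r S → P s T → P (r + s) (S + T))
    (scalar : ∀ c : ℂ, P (algebraMap ℂ R c) (algebraMap ℂ (H →L[ℂ] H) c)) :
    R →ₐ[ℂ] (H →L[ℂ] H) where
  toFun r := (ex r).choose
  map_one' := uniq 1 _ _ (ex 1).choose_spec (by simpa using scalar 1)
  map_mul' r s := uniq _ _ _ (ex _).choose_spec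
    (mul r s _ _ (ex r).choose_spec (ex s).choose_spec)
  map_zero' := uniq 0 _ _ (ex 0).choose_spec (by simpa using scalar 0)
  map_add' r s := uniq _ _ _ (ex _).choose_spec
    (add r s _ _ (ex r).choose_spec (ex s).choose_spec)
  commutes' c := uniq _ _ _ (ex _).choose_spec (scalar c)

end action

/-- Two Hilbert modules over `R`, given by their actions `r ↦ T r` by bounded operators, are
unitarily equivalent if a unitary operator intertwines the two actions. -/
def UnitarilyEquivalent {R H H' : Type*} [CommRing R] [Algebra ℂ R]
    [NormedAddCommGroup H] [InnerProductSpace ℂ H]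
    [NormedAddCommGroup H'] [InnerProductSpace ℂ H']
    (T : R →ₐ[ℂ] (H →L[ℂ] H)) (T' : R →ₐ[ℂ] (H' →L[ℂ] H')) : Prop :=
  ∃ U : H ≃ₗᵢ[ℂ] H', ∀ (r : R) (h : H), U (T r h) = T' r (U h)

/-- The ring `ℂ[z]^{𝔖ₙ}` of symmetric polynomials in `n` variables. -/
abbrev SymPoly (n : ℕ) : Subalgebra ℂ (MvPolynomial (Fin n) ℂ) :=
  MvPolynomial.symmetricSubalgebra (Fin n) ℂ

theorem BergmanSpace.exists_mul (n : ℕ) (lam : ℝ) [Fact (0 < lam)] (p : MvPolynomial (Fin n) ℂ) :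
    ∃ T : BergmanSpace n lam →L[ℂ] BergmanSpace n lam,
      ∀ (f : BergmanSpace n lam) (z : polydisc n), T f z = MvPolynomial.eval z.1 p * f z := by
  induction p using MvPolynomial.induction_on with
  | C c => exact ⟨algebraMap ℂ _ c, fun f z => by simp [Algebra.algebraMap_eq_smul_one]⟩
  | add p q hp hq =>
    obtain ⟨S, hS⟩ := hp
    obtain ⟨T, hT⟩ := hq
    exact ⟨S + T, fun f z => by simp [hS, hT, add_mul]⟩
  | mul_X p i hp =>
    obtain ⟨S, hS⟩ := hp
    obtain ⟨T, hT⟩ := BergmanSpace.exists_coord_mul n lam i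
    exact ⟨S * T, fun f z => by simp [hS, hT, mul_assoc]⟩

/-- `σ • z = (z_{σ⁻¹(1)}, …, z_{σ⁻¹(n)})` on the polydisc. -/
def permPolydisc {n : ℕ} (σ : Equiv.Perm (Fin n)) (z : polydisc n) : polydisc n :=
  ⟨fun i => z.1 (σ⁻¹ i), fun i => z.2 (σ⁻¹ i)⟩

/-- `𝔸_sym^(λ)(𝔻ⁿ)`: the `f` in `𝔸^(λ)(𝔻ⁿ)` with `f ∘ σ⁻¹ = f` for all `σ`. -/
def symPart (n : ℕ) (lam : ℝ) [Fact (0 < lam)] : Submodule ℂ (BergmanSpace n lam) where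
  carrier := {f | ∀ (σ : Equiv.Perm (Fin n)) (z : polydisc n), f (permPolydisc σ⁻¹ z) = f z}
  add_mem' {f g} hf hg σ z := by simp [hf σ z, hg σ z]
  zero_mem' σ z := by simp
  smul_mem' c f hf σ z := by simp [hf σ z]

/-- `𝔸_anti^(λ)(𝔻ⁿ)`: the `f` in `𝔸^(λ)(𝔻ⁿ)` with `f ∘ σ⁻¹ = sgn(σ) f` for all `σ`. -/
def antiPart (n : ℕ) (lam : ℝ) [Fact (0 < lam)] : Submodule ℂ (BergmanSpace n lam) where
  carrier := {f | ∀ (σ : Equiv.Perm (Fin n)) (z : polydisc n),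
    f (permPolydisc σ⁻¹ z) = ((Equiv.Perm.sign σ : ℤ) : ℂ) * f z}
  add_mem' {f g} hf hg σ z := by simp [hf σ z, hg σ z, mul_add]
  zero_mem' σ z := by simp
  smul_mem' c f hf σ z := by simp [hf σ z, mul_left_comm]

theorem eval_permPolydisc {n : ℕ} (p : SymPoly n) (σ : Equiv.Perm (Fin n)) (z : polydisc n) :
    MvPolynomial.eval (permPolydisc σ z).1 p.1 = MvPolynomial.eval z.1 p.1 := by
  conv_rhs => rw [← (MvPolynomial.mem_symmetricSubalgebra p.1).1 p.2 σ⁻¹]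
  rw [MvPolynomial.eval_rename]
  rfl

/-- Multiplication by symmetric polynomials on a subspace of `𝔸^(λ)(𝔻ⁿ)` that is invariant under
it: `(T p f)(z) = p(z) f(z)`. -/
def mulAction {n : ℕ} {lam : ℝ} [Fact (0 < lam)] (M : Submodule ℂ (BergmanSpace n lam))
    (hM : ∀ (p : SymPoly n), ∀ f ∈ M, ∀ g : BergmanSpace n lam,
      (∀ z : polydisc n, g z = MvPolynomial.eval z.1 p.1 * f z) → g ∈ M) :
    SymPoly n →ₐ[ℂ] (M →L[ℂ] M) :=
  actionOfSpec
    (fun p T => ∀ (f : M) (z : polydisc n), (T f).1 z = MvPolynomial.eval z.1 p.1 * f.1 z)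
    (fun p => by
      obtain ⟨T, hT⟩ := BergmanSpace.exists_mul n lam p.1
      exact ⟨(T.comp M.subtypeL).codRestrict M fun f => hM p f.1 f.2 _ fun z => hT f.1 z,
        fun f z => hT f.1 z⟩)
    (fun p S T hS hT => by
      ext f : 2
      exact RKHS.ext fun z => by rw [hS, hT])
    (fun p q S T hS hT f z => by
      simp [hS, hT, mul_assoc])
    (fun p q S T hS hT f z => by simp [hS, hT, add_mul])
    (fun c f z => by simp [Algebra.algebraMap_eq_smul_one])

theorem mulAction_apply {n : ℕ} {lam : ℝ} [Fact (0 < lam)] (M : Submodule ℂ (BergmanSpace n lam))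
    (hM) (p : SymPoly n) (f : M) (z : polydisc n) :
    (mulAction M hM p f).1 z = MvPolynomial.eval z.1 p.1 * f.1 z :=
  Exists.choose_spec (p := fun T : M →L[ℂ] M => ∀ (f : M) (z : polydisc n),
    (T f).1 z = MvPolynomial.eval z.1 p.1 * f.1 z) _ f z

/-- The Hilbert module `𝔸_sym^(λ)(𝔻ⁿ)` over `ℂ[z]^{𝔖ₙ}`. -/
def symAction (n : ℕ) (lam : ℝ) [Fact (0 < lam)] :
    SymPoly n →ₐ[ℂ] (symPart n lam →L[ℂ] symPart n lam) :=
  mulAction (symPart n lam) fun p f hf g hg σ z => by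
    rw [hg, hg, eval_permPolydisc, hf]

/-- The Hilbert module `𝔸_anti^(λ)(𝔻ⁿ)` over `ℂ[z]^{𝔖ₙ}`. -/
def antiAction (n : ℕ) (lam : ℝ) [Fact (0 < lam)] :
    SymPoly n →ₐ[ℂ] (antiPart n lam →L[ℂ] antiPart n lam) :=
  mulAction (antiPart n lam) fun p f hf g hg σ z => by
    rw [hg, hg, eval_permPolydisc, hf]; ring

/-- The symmetrization map `s = (s₁, …, sₙ)` given by the elementary symmetric functions. -/
def symmetrization (n : ℕ) (z : Fin n → ℂ) : Fin n → ℂ :=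
  fun k => MvPolynomial.eval z (MvPolynomial.esymm (Fin n) ℂ (k + 1))

/-- The symmetrized polydisc `𝔾ₙ = s(𝔻ⁿ)`. -/
def symmetrizedPolydisc (n : ℕ) : Set (Fin n → ℂ) := symmetrization n '' polydisc n

/-- The point `s(z)` of `𝔾ₙ`. -/
def toSymm {n : ℕ} (z : polydisc n) : symmetrizedPolydisc n :=
  ⟨symmetrization n z.1, z.1, z.2, rfl⟩

/-- The value at `u` of a symmetric polynomial `p = q(s₁, …, sₙ)`, seen as a function of
the coordinates `u = (s₁, …, sₙ)`, i.e. `q(u)`. -/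
def symmValue {n : ℕ} (p : SymPoly n) (u : Fin n → ℂ) : ℂ :=
  MvPolynomial.eval u ((MvPolynomial.esymmAlgEquiv (R := ℂ) (Fin n) (Fintype.card_fin n)).symm p)

theorem symmValue_symmetrization {n : ℕ} (p : SymPoly n) (z : Fin n → ℂ) :
    symmValue p (symmetrization n z) = MvPolynomial.eval z p.1 := by
  obtain ⟨q, rfl⟩ := (MvPolynomial.esymmAlgEquiv (R := ℂ) (Fin n) (Fintype.card_fin n)).surjective p
  rw [symmValue, AlgEquiv.symm_apply_apply]
  simp only [MvPolynomial.esymmAlgEquiv_apply]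
  rw [MvPolynomial.esymmAlgHom_apply]
  induction q using MvPolynomial.induction_on with
  | C c => simp
  | add p q hp hq => simp [hp, hq]
  | mul_X p i hp => simp [hp, symmetrization]

theorem differentiable_symmValue {n : ℕ} (p : SymPoly n) : Differentiable ℂ (symmValue p) := by
  have h : ∀ q : MvPolynomial (Fin n) ℂ, Differentiable ℂ fun u => MvPolynomial.eval u q := by
    intro q
    induction q using MvPolynomial.induction_on with
    | C c => simp
    | add p q hp hq => simp only [map_add]; exact hp.add hq
    | mul_X p i hp =>
      simp only [map_mul, MvPolynomial.eval_X]
      exact hp.mul (differentiable_apply i)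
  exact h _

theorem isOpen_polydisc (n : ℕ) : IsOpen (polydisc n) := by
  have : polydisc n = ⋂ i, {z | ‖z i‖ < 1} := by ext; simp [polydisc]
  rw [this]
  exact isOpen_iInter_of_finite fun i => isOpen_lt (by fun_prop) continuous_const

theorem continuous_symmetrization (n : ℕ) : Continuous (symmetrization n) :=
  continuous_pi fun _ => MvPolynomial.continuous_eval _

/-- The functions `g` on `𝔾ₙ` that are holomorphic and for which `ρ · (g ∘ s)` belongs to
`𝔸^(λ)(𝔻ⁿ)`, where `ρ` is a fixed polynomial. -/
def weightedPullbackSubmodule (n : ℕ) (lam : ℝ) [Fact (0 < lam)] (ρ : MvPolynomial (Fin n) ℂ) :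
    Submodule ℂ (symmetrizedPolydisc n → ℂ) where
  carrier := {g |
    (∃ G : (Fin n → ℂ) → ℂ, DifferentiableOn ℂ G (symmetrizedPolydisc n) ∧ ∀ u, g u = G u.1) ∧
    ∃ f : BergmanSpace n lam, ∀ z : polydisc n, f z = MvPolynomial.eval z.1 ρ * g (toSymm z)}
  add_mem' := by
    rintro g g' ⟨⟨G, hG, hg⟩, f, hf⟩ ⟨⟨G', hG', hg'⟩, f', hf'⟩
    exact ⟨⟨G + G', hG.add hG', fun u => by simp [hg, hg']⟩, f + f', fun z => by
      simp [hf, hf', mul_add]⟩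
  zero_mem' := ⟨⟨0, differentiableOn_const 0, fun u => rfl⟩, 0, fun z => by simp⟩
  smul_mem' := by
    rintro c g ⟨⟨G, hG, hg⟩, f, hf⟩
    exact ⟨⟨c • G, hG.const_smul c, fun u => by simp [hg]⟩, c • f, fun z => by
      simp [hf, mul_left_comm]⟩

/-- The space `{g : 𝔾ₙ → ℂ holomorphic | ρ · (g ∘ s) ∈ 𝔸^(λ)(𝔻ⁿ)}`, to be normed by
`‖g‖ = ‖ρ · (g ∘ s)‖`. -/
def WeightedPullbackSpace (n : ℕ) (lam : ℝ) [Fact (0 < lam)] (ρ : MvPolynomial (Fin n) ℂ) : Type :=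
  weightedPullbackSubmodule n lam ρ

namespace WeightedPullbackSpace
variable {n : ℕ} {lam : ℝ} [Fact (0 < lam)] {ρ : MvPolynomial (Fin n) ℂ}

instance instAddCommGroup : AddCommGroup (WeightedPullbackSpace n lam ρ) :=
  inferInstanceAs (AddCommGroup (weightedPullbackSubmodule n lam ρ))

instance instModule : Module ℂ (WeightedPullbackSpace n lam ρ) :=
  inferInstanceAs (Module ℂ (weightedPullbackSubmodule n lam ρ))

/-- The underlying function on `𝔾ₙ`. -/
def toFun : WeightedPullbackSpace n lam ρ →ₗ[ℂ] (symmetrizedPolydisc n → ℂ) :=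
  (weightedPullbackSubmodule n lam ρ).subtype

theorem toFun_injective : Function.Injective (toFun (n := n) (lam := lam) (ρ := ρ)) :=
  Subtype.val_injective

/-- The linear map `g ↦ ρ · (g ∘ s)` into `𝔸^(λ)(𝔻ⁿ)`. -/
def lift : WeightedPullbackSpace n lam ρ →ₗ[ℂ] BergmanSpace n lam where
  toFun g := g.2.2.choose
  map_add' g g' := RKHS.ext fun z => by
    have h := (g + g').2.2.choose_spec z
    have h1 := g.2.2.choose_spec z
    have h2 := g'.2.2.choose_spec z
    rw [RKHS.coe_add, Pi.add_apply, h1, h2, ← mul_add]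
    exact h
  map_smul' c g := RKHS.ext fun z => by
    have h := (c • g).2.2.choose_spec z
    have h1 := g.2.2.choose_spec z
    rw [RingHom.id_apply, RKHS.coe_smul, Pi.smul_apply, h1, smul_eq_mul, mul_left_comm]
    exact h

theorem lift_apply (g : WeightedPullbackSpace n lam ρ) (z : polydisc n) :
    lift g z = MvPolynomial.eval z.1 ρ * toFun g (toSymm z) := g.2.2.choose_spec z

theorem lift_injective [hρ : NeZero ρ] :
    Function.Injective (lift (n := n) (lam := lam) (ρ := ρ)) := by
  refine (injective_iff_map_eq_zero _).2 fun g hg => toFun_injective ?_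
  have h0 : ∀ z : polydisc n, MvPolynomial.eval z.1 ρ * toFun g (toSymm z) = 0 := fun z => by
    rw [← lift_apply, hg]; simp
  obtain ⟨⟨G, hG, hgG⟩, -⟩ := g.2
  have hgG' : ∀ u, toFun g u = G u.1 := hgG
  rw [map_zero]
  funext ⟨u, z, hz, hzu⟩
  subst hzu
  obtain ⟨w, hw⟩ : ∃ w, MvPolynomial.eval w ρ ≠ 0 := by
    by_contra! h
    exact hρ.out (MvPolynomial.funext fun x => by simp [h])
  let L : ℂ → Fin n → ℂ := fun t i => z i + t * (w i - z i)
  let q : Polynomial ℂ := MvPolynomial.aeval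
    (fun i => Polynomial.C (z i) + Polynomial.X * Polynomial.C (w i - z i)) ρ
  have hLt : ∀ t i, L t i = z i + t * (w i - z i) := fun _ _ => rfl
  have hq : ∀ t, q.eval t = MvPolynomial.eval (L t) ρ := by
    intro t
    simp only [q]
    clear_value L
    generalize ρ = r
    induction r using MvPolynomial.induction_on with
    | C c => simp
    | add p q hp hq => rw [map_add, map_add, Polynomial.eval_add, hp, hq]
    | mul_X p i hp => rw [map_mul, map_mul, Polynomial.eval_mul, hp]; simp [hLt]
  have hq0 : q ≠ 0 := by
    intro h
    have := hq 1
    simp [h, L] at this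
    exact hw this.symm
  have hL : Continuous L := by fun_prop
  have hL0 : L 0 = z := by funext i; simp [L]
  have hmem : ∀ᶠ t in nhds (0 : ℂ), L t ∈ polydisc n :=
    hL.continuousAt.eventually_mem (by rw [hL0]; exact (isOpen_polydisc n).mem_nhds hz)
  have hcont : Filter.Tendsto (fun t => G (symmetrization n (L t))) (nhdsWithin 0 {0}ᶜ)
      (nhds (G (symmetrization n z))) := by
    have h1 : Filter.Tendsto (fun t => symmetrization n (L t)) (nhdsWithin 0 {0}ᶜ)
        (nhdsWithin (symmetrization n z) (symmetrizedPolydisc n)) := by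
      refine tendsto_nhdsWithin_iff.2 ⟨?_, ?_⟩
      · have := ((continuous_symmetrization n).comp hL).tendsto 0
        simp only [Function.comp_apply, hL0] at this
        exact this.mono_left nhdsWithin_le_nhds
      · exact (hmem.filter_mono nhdsWithin_le_nhds).mono fun t ht => ⟨_, ht, rfl⟩
    exact (hG.continuousOn _ ⟨z, hz, rfl⟩).tendsto.comp h1
  have hev : ∀ᶠ t in nhdsWithin (0 : ℂ) {0}ᶜ, G (symmetrization n (L t)) = 0 := by
    have hfin : ∀ᶠ t in nhdsWithin (0 : ℂ) {0}ᶜ, q.eval t ≠ 0 := by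
      refine nhdsNE_le_cofinite 0 ?_
      have := Polynomial.finite_setOfPred_isRoot hq0
      refine this.subset fun t ht => ?_
      simpa using ht
    filter_upwards [hfin, hmem.filter_mono nhdsWithin_le_nhds] with t ht hmt
    rw [hq] at ht
    have := (mul_eq_zero.1 (h0 ⟨L t, hmt⟩)).resolve_left ht
    rw [hgG'] at this
    exact this
  have := tendsto_nhds_unique hcont (tendsto_const_nhds.congr' (hev.mono fun t ht => ht.symm))
  rw [hgG', this]
  rfl

/-- The norm `‖g‖ = ‖ρ · (g ∘ s)‖`. -/
instance instNormedAddCommGroup [NeZero ρ] : NormedAddCommGroup (WeightedPullbackSpace n lam ρ) :=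
  NormedAddCommGroup.induced _ _ lift lift_injective

/-- The inner product `⟨g₁, g₂⟩ = ⟨ρ · (g₁ ∘ s), ρ · (g₂ ∘ s)⟩`. -/
instance instInnerProductSpace [NeZero ρ] : InnerProductSpace ℂ (WeightedPullbackSpace n lam ρ) :=
  InnerProductSpace.induced lift

/-- Multiplication by symmetric polynomials: `(T p g)(s(z)) = p(z) g(s(z))`. -/
def action [NeZero ρ] :
    SymPoly n →ₐ[ℂ] (WeightedPullbackSpace n lam ρ →L[ℂ] WeightedPullbackSpace n lam ρ) :=
  actionOfSpec
    (fun p T => ∀ (g : WeightedPullbackSpace n lam ρ) (u : symmetrizedPolydisc n),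
      toFun (T g) u = symmValue p u.1 * toFun g u)
    (fun p => by
      obtain ⟨T, hT⟩ := BergmanSpace.exists_mul n lam p.1
      have hmem : ∀ g : WeightedPullbackSpace n lam ρ,
          (fun u => symmValue p u.1 * toFun g u) ∈ weightedPullbackSubmodule n lam ρ := by
        intro g
        obtain ⟨⟨G, hG, hg⟩, -⟩ := g.2
        refine ⟨⟨fun u => symmValue p u * G u, ?_, fun u => ?_⟩, T (lift g), fun z => ?_⟩
        · exact (differentiable_symmValue p).differentiableOn.mul hG
        · exact congrArg (symmValue p u.1 * ·) (hg u)
        · rw [hT, lift_apply]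
          simp only [toSymm, symmValue_symmetrization]
          ring
      let S : WeightedPullbackSpace n lam ρ →ₗ[ℂ] WeightedPullbackSpace n lam ρ :=
        { toFun := fun g => ⟨_, hmem g⟩
          map_add' := fun g g' => toFun_injective (funext fun u => by
            change symmValue p u.1 * toFun (g + g') u =
              symmValue p u.1 * toFun g u + symmValue p u.1 * toFun g' u
            rw [map_add, Pi.add_apply, mul_add])
          map_smul' := fun c g => toFun_injective (funext fun u => by
            change symmValue p u.1 * toFun (c • g) u = c * (symmValue p u.1 * toFun g u)
            rw [map_smul, Pi.smul_apply, smul_eq_mul, mul_left_comm]) }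
      have hS : ∀ g u, toFun (S g) u = symmValue p u.1 * toFun g u := fun g u => rfl
      have hlift : ∀ g, lift (S g) = T (lift g) := fun g => RKHS.ext fun z => by
        rw [hT, lift_apply, lift_apply, hS]
        simp only [toSymm, symmValue_symmetrization]
        ring
      exact ⟨S.mkContinuous ‖T‖ fun g => by
        change ‖lift (S g)‖ ≤ ‖T‖ * ‖lift g‖
        rw [hlift]
        exact T.le_opNorm _, fun g u => hS g u⟩)
    (fun p S T hS hT => ContinuousLinearMap.ext fun g => toFun_injective (funext fun u => by
      rw [hS, hT]))
    (fun p q S T hS hT g u => by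
      rw [mul_apply_eq_comp, hS, hT]
      simp [symmValue, mul_assoc])
    (fun p q S T hS hT g u => by
      rw [add_apply, map_add, Pi.add_apply, hS, hT]
      simp [symmValue, add_mul])
    (fun c g u => by
      simp [Algebra.algebraMap_eq_smul_one, symmValue])

theorem action_apply [NeZero ρ] (p : SymPoly n) (g : WeightedPullbackSpace n lam ρ)
    (u : symmetrizedPolydisc n) : toFun (action p g) u = symmValue p u.1 * toFun g u :=
  Exists.choose_spec (p := fun T : WeightedPullbackSpace n lam ρ →L[ℂ] WeightedPullbackSpace n lam ρ =>
    ∀ (g : WeightedPullbackSpace n lam ρ) (u : symmetrizedPolydisc n),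
      toFun (T g) u = symmValue p u.1 * toFun g u) _ g u

end WeightedPullbackSpace

/-- The Hilbert space `ℋ^(λ)(𝔾ₙ)` of the holomorphic functions `g` on `𝔾ₙ` with
`g ∘ s ∈ 𝔸^(λ)(𝔻ⁿ)`, with inner product `⟨g₁, g₂⟩ = ⟨g₁ ∘ s, g₂ ∘ s⟩`. -/
abbrev PullbackSpace (n : ℕ) (lam : ℝ) [Fact (0 < lam)] : Type := WeightedPullbackSpace n lam 1

/-- The Hilbert module `ℋ^(λ)(𝔾ₙ)` over `ℂ[z]^{𝔖ₙ}`. -/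
def pullbackAction (n : ℕ) (lam : ℝ) [Fact (0 < lam)] :
    SymPoly n →ₐ[ℂ] (PullbackSpace n lam →L[ℂ] PullbackSpace n lam) :=
  WeightedPullbackSpace.action

/-- The complex Jacobian `J_s(z) = ∏_{i<j} (zᵢ - zⱼ)` of the symmetrization map. -/
def jacobian (n : ℕ) : MvPolynomial (Fin n) ℂ :=
  ∏ i, ∏ j ∈ Finset.Ioi i, (MvPolynomial.X i - MvPolynomial.X j)

/-- The weight `J_s / √(n!)`. -/
def jacobianWeight (n : ℕ) : MvPolynomial (Fin n) ℂ :=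
  MvPolynomial.C ((1 / √(n.factorial : ℝ) : ℝ) : ℂ) * jacobian n

instance neZero_jacobianWeight (n : ℕ) : NeZero (jacobianWeight n) := ⟨by
  refine mul_ne_zero ?_ ?_
  · rw [Ne, MvPolynomial.C_eq_zero, Complex.ofReal_eq_zero]
    positivity
  · refine Finset.prod_ne_zero_iff.2 fun i _ => Finset.prod_ne_zero_iff.2 fun j hj => ?_
    rw [sub_ne_zero]
    exact fun h => (Finset.mem_Ioi.1 hj).ne (MvPolynomial.X_injective h)⟩

/-- The weighted Bergman space `𝔸^(λ)(𝔾ₙ)` for arbitrary `λ > 0`: the holomorphic functions `g` on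
`𝔾ₙ` with `J_s · (g ∘ s) ∈ 𝔸^(λ)(𝔻ⁿ)`, with the inner product
`⟨g₁, g₂⟩ = (1/n!) ⟨J_s · (g₁ ∘ s), J_s · (g₂ ∘ s)⟩`. -/
abbrev SymmetrizedBergmanSpace (n : ℕ) (lam : ℝ) [Fact (0 < lam)] : Type :=
  WeightedPullbackSpace n lam (jacobianWeight n)

/-- The weighted Bergman module `𝔸^(λ)(𝔾ₙ)` over `ℂ[z]^{𝔖ₙ}`, for arbitrary `λ > 0`. -/
def symmetrizedBergmanAction (n : ℕ) (lam : ℝ) [Fact (0 < lam)] :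
    SymPoly n →ₐ[ℂ] (SymmetrizedBergmanSpace n lam →L[ℂ] SymmetrizedBergmanSpace n lam) :=
  WeightedPullbackSpace.action

open MeasureTheory

/-- The probability measure `dV^(μ) = ∏ᵢ ((μ-1)/π) (1 - |zᵢ|²)^(μ-2) dA(zᵢ)` on the polydisc,
for `μ > 1`. -/
def bergmanMeasure (n : ℕ) (mu : ℝ) : Measure (Fin n → ℂ) :=
  (volume.restrict (polydisc n)).withDensity fun z =>
    ENNReal.ofReal (∏ i, (mu - 1) / Real.pi * (1 - ‖z i‖ ^ 2) ^ (mu - 2))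

/-- The measure `dV_s^(μ)` on the symmetrized polydisc, with
`∫ f dV_s^(μ) = (1/n!) ∫ (f ∘ s) |J_s|² dV^(μ)`. -/
def symmBergmanMeasure (n : ℕ) (mu : ℝ) : Measure (Fin n → ℂ) :=
  (n.factorial : ENNReal)⁻¹ • ((bergmanMeasure n mu).withDensity fun z =>
    ‖MvPolynomial.eval z (jacobian n)‖ₑ ^ 2).map (symmetrization n)

/-- The weighted Bergman space for `μ > 1` as the subspace of `L²(𝔾ₙ, dV_s^(μ))` consisting of holomorphic functions. -/
def squareIntegrableBergman (n : ℕ) (mu : ℝ) :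
    Submodule ℂ (Lp ℂ 2 (symmBergmanMeasure n mu)) where
  carrier := {F | ∃ G : (Fin n → ℂ) → ℂ, DifferentiableOn ℂ G (symmetrizedPolydisc n) ∧
    F =ᵐ[symmBergmanMeasure n mu] G}
  add_mem' := by
    rintro F F' ⟨G, hG, hF⟩ ⟨G', hG', hF'⟩
    exact ⟨G + G', hG.add hG', (Lp.coeFn_add F F').trans (hF.add hF')⟩
  zero_mem' := ⟨0, differentiableOn_const 0, Lp.coeFn_zero _ _ _⟩
  smul_mem' := by
    rintro c F ⟨G, hG, hF⟩
    exact ⟨c • G, hG.const_smul c, (Lp.coeFn_smul c F).trans (hF.const_smul c)⟩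

theorem exists_bound_symmValue {n : ℕ} (mu : ℝ) (p : SymPoly n) :
    ∃ C : ℝ, 0 ≤ C ∧ ∀ᵐ u ∂(symmBergmanMeasure n mu), ‖symmValue p u‖ ≤ C := by
  have hK : IsCompact (Metric.closedBall (0 : Fin n → ℂ) 1) := isCompact_closedBall 0 1
  obtain ⟨C, hC⟩ := hK.exists_bound_of_continuousOn
    (MvPolynomial.continuous_eval p.1).continuousOn
  have hmeas : MeasurableSet {u : Fin n → ℂ | ‖symmValue p u‖ ≤ C} :=
    (isClosed_le (differentiable_symmValue p).continuous.norm continuous_const).measurableSet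
  refine ⟨C, (norm_nonneg _).trans (hC 0 (by simp)), ?_⟩
  refine Measure.ae_smul_measure ?_ _
  rw [ae_map_iff (continuous_symmetrization n).aemeasurable hmeas]
  refine (withDensity_absolutelyContinuous _ _).ae_le
    ((withDensity_absolutelyContinuous _ _).ae_le ?_)
  refine ae_restrict_of_forall_mem (isOpen_polydisc n).measurableSet fun z hz => ?_
  rw [symmValue_symmetrization]
  refine hC z ?_
  rw [mem_closedBall_zero_iff, pi_norm_le_iff_of_nonneg zero_le_one]
  exact fun i => (hz i).le

/-- Multiplication by symmetric polynomials on the Bergman space of `𝔾ₙ`: `(T p F)(u) = p(u) F(u)`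
for almost every `u`. -/
def squareIntegrableBergmanAction (n : ℕ) (mu : ℝ) :
    SymPoly n →ₐ[ℂ] (squareIntegrableBergman n mu →L[ℂ] squareIntegrableBergman n mu) :=
  actionOfSpec
    (fun p T => ∀ F : squareIntegrableBergman n mu,
      (T F).1 =ᵐ[symmBergmanMeasure n mu] fun u => symmValue p u * F.1 u)
    (fun p => by
      obtain ⟨C, hC0, hC⟩ := exists_bound_symmValue mu p
      have hle : ∀ F : Lp ℂ 2 (symmBergmanMeasure n mu), ∀ᵐ u ∂(symmBergmanMeasure n mu),
          ‖symmValue p u * F u‖ ≤ C * ‖F u‖ := fun F => hC.mono fun u hu => by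
        rw [norm_mul]; gcongr
      have hmem : ∀ F : Lp ℂ 2 (symmBergmanMeasure n mu),
          MemLp (fun u => symmValue p u * F u) 2 (symmBergmanMeasure n mu) := fun F =>
        (Lp.memLp F).of_le_mul
          ((differentiable_symmValue p).continuous.aestronglyMeasurable.mul
            (Lp.aestronglyMeasurable F)) (hle F)
      have hco : ∀ F, (hmem F).toLp =ᵐ[symmBergmanMeasure n mu] fun u => symmValue p u * F u :=
        fun F => (hmem F).coeFn_toLp
      let S : squareIntegrableBergman n mu →ₗ[ℂ] squareIntegrableBergman n mu :=
        { toFun := fun F => ⟨(hmem F.1).toLp, by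
            obtain ⟨G, hG, hF⟩ := F.2
            refine ⟨fun u => symmValue p u * G u,
              (differentiable_symmValue p).differentiableOn.mul hG, ?_⟩
            filter_upwards [hco F.1, hF] with u h1 h2
            rw [h1, h2]⟩
          map_add' := fun F F' => Subtype.ext (Lp.ext (by
            filter_upwards [hco (F.1 + F'.1), hco F.1, hco F'.1, Lp.coeFn_add F.1 F'.1,
              Lp.coeFn_add (hmem F.1).toLp (hmem F'.1).toLp] with u h1 h2 h3 h4 h5
            refine Eq.trans h1 (Eq.trans ?_ h5.symm)
            rw [Pi.add_apply, h2, h3, h4, Pi.add_apply, mul_add]))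
          map_smul' := fun c F => Subtype.ext (Lp.ext (by
            filter_upwards [hco (c • F.1), hco F.1, Lp.coeFn_smul c F.1,
              Lp.coeFn_smul c (hmem F.1).toLp] with u h1 h2 h4 h5
            refine Eq.trans h1 (Eq.trans ?_ h5.symm)
            rw [Pi.smul_apply, h2, h4, Pi.smul_apply, smul_eq_mul, smul_eq_mul, mul_left_comm])) }
      refine ⟨S.mkContinuous C fun F => ?_, fun F => hco F.1⟩
      refine Lp.norm_le_mul_norm_of_ae_le_mul ?_
      filter_upwards [hco F.1, hle F.1] with u h1 h2
      exact (congrArg norm h1).trans_le h2)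
    (fun p S T hS hT => ContinuousLinearMap.ext fun F =>
      Subtype.ext (Lp.ext ((hS F).trans (hT F).symm)))
    (fun p q S T hS hT F => by
      filter_upwards [hS (T F), hT F] with u h1 h2
      refine Eq.trans h1 ?_
      rw [h2]
      simp [symmValue, mul_assoc])
    (fun p q S T hS hT F => by
      filter_upwards [hS F, hT F, Lp.coeFn_add (S F).1 (T F).1] with u h1 h2 h3
      refine Eq.trans h3 ?_
      rw [Pi.add_apply, h1, h2]
      simp [symmValue, add_mul])
    (fun c F => by
      filter_upwards [Lp.coeFn_smul c F.1] with u h1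
      refine Eq.trans h1 ?_
      simp [symmValue])

theorem squareIntegrableBergmanAction_apply (n : ℕ) (mu : ℝ) (p : SymPoly n)
    (F : squareIntegrableBergman n mu) :
    (squareIntegrableBergmanAction n mu p F).1 =ᵐ[symmBergmanMeasure n mu]
      fun u => symmValue p u * F.1 u :=
  Exists.choose_spec (p := fun T : squareIntegrableBergman n mu →L[ℂ] squareIntegrableBergman n mu =>
    ∀ F : squareIntegrableBergman n mu,
      (T F).1 =ᵐ[symmBergmanMeasure n mu] fun u => symmValue p u * F.1 u) _ F

end

/-!
The monomials `z^m` are orthogonal in `𝔸^(λ)(𝔻ⁿ)`, and `‖z^m‖² = ∏ⱼ a(mⱼ)` with `a(k) = k! / (λ)ₖ`, the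
reciprocal of the Taylor coefficient of `(1 - t)^(-λ)`. This follows from the expansion of the kernel
and the uniqueness of power series (`exists_linearIsometryEquiv_lp`,
`BergmanSpace.exists_monomial_basis`).

In a Hilbert module over the symmetric polynomials, consider the vectors `v` that are orthogonal to
`p · x` for every `x` and every symmetric `p` without constant term. Unitary equivalences preserve
these vectors. In the modules of symmetric functions they are the constants
(`BergmanSpace.coeff_eq_zero_of_mem_symPart`), so that `‖(z₁ + ⋯ + zₙ) v‖² / ‖v‖² = n a(1) = n / λ`.
In the modules of antisymmetric functions the Vandermonde determinant is such a vector, because every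
monomial of an antisymmetric function has distinct exponents and the Vandermonde determinant consists
of those of lowest degree (`BergmanSpace.inner_jacobian_eq_zero`). By Pieri's rule
(`sum_X_mul_alternant_val`), `(z₁ + ⋯ + zₙ) J_s` is, up to sign, the alternant with exponents
`0, …, n - 2, n`, so the ratio is `a(n) / a(n - 1) = n / (λ + n - 1)` there. The two ratios differ for
`n ≥ 2` (`not_unitarilyEquivalent_of_orthogonal`).

On the `L²` space over `𝔾ₙ` the same vector is the constant `1`. It has the orthogonality property by
the mean value property along the discs `t ↦ s(t z)`, as `|J_s|² dV^(λ)` is invariant under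
`z ↦ e^{iθ} z` (`inner_one_eq_zero`), and the norms come from the moments of the weight of the disc,
which satisfy the same recurrence as the numbers `a(k)` (`discMoment_succ`).
-/

/-! ### Power series in several variables -/

theorem eq_zero_of_hasSum_pow_mul_eq_zero (a : ℕ → ℂ)
    (h : ∀ t : ℂ, ‖t‖ < 1 → HasSum (fun k => t ^ k * a k) 0) : a = 0 := by
  have hp : HasFPowerSeriesAt (0 : ℂ → ℂ) (FormalMultilinearSeries.ofScalars ℂ a) 0 := by
    rw [hasFPowerSeriesAt_iff]
    filter_upwards [Metric.ball_mem_nhds (0 : ℂ) one_pos] with t ht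
    simp only [FormalMultilinearSeries.coeff_ofScalars, smul_eq_mul]
    exact h t (by simpa using ht)
  funext k
  have := congrArg (fun p => FormalMultilinearSeries.coeff p k) hp.eq_zero
  rw [FormalMultilinearSeries.coeff_ofScalars] at this
  simpa [FormalMultilinearSeries.coeff] using this

/-- A power series in several variables that sums to zero on the polydisc has zero coefficients. -/
theorem eq_zero_of_hasSum_monomials_eq_zero {n : ℕ} (c : (Fin n → ℕ) → ℂ)
    (h : ∀ z ∈ polydisc n, HasSum (fun m => c m * ∏ i, z i ^ m i) 0) : c = 0 := by
  induction n with
  | zero =>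
    have := (h 0 (fun i => i.elim0)).unique (hasSum_fintype _)
    funext m
    rw [Subsingleton.elim m (Unique.instInhabited.default : Fin 0 → ℕ)]
    rw [Fintype.sum_unique, Finset.univ_eq_empty, Finset.prod_empty, mul_one] at this
    exact this.symm
  | succ n ih =>
    have key : ∀ t : ℂ, ‖t‖ < 1 → ∀ w ∈ polydisc n,
        HasSum (fun p : ℕ × (Fin n → ℕ) =>
          t ^ p.1 * (c (Fin.cons p.1 p.2) * ∏ i, w i ^ p.2 i)) 0 := by
      intro t ht w hw
      have h1 := h (Fin.cons t w) (fun i => by refine Fin.cases ?_ (fun j => ?_) i <;> simp [ht, hw _])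
      rw [← (Fin.consEquiv (fun _ : Fin (n + 1) => ℕ)).hasSum_iff] at h1
      refine h1.congr_fun fun p => ?_
      simp [Fin.consEquiv, Fin.prod_univ_succ]
      ring
    have hs : ∀ w ∈ polydisc n, ∀ k,
        Summable fun m : Fin n → ℕ => c (Fin.cons k m) * ∏ i, w i ^ m i := by
      intro w hw k
      have h1 := (key (1 / 2) (by norm_num) w hw).summable.prod_factor k
      have h2 := h1.mul_left (((1 / 2 : ℂ) ^ k)⁻¹)
      refine h2.congr fun m => ?_
      rw [inv_mul_cancel_left₀ (pow_ne_zero _ (by norm_num))]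
    have hz : ∀ k, (fun m => c (Fin.cons k m)) = 0 := by
      intro k
      refine ih _ fun w hw => ?_
      have h1 := eq_zero_of_hasSum_pow_mul_eq_zero
        (fun k => ∑' m : Fin n → ℕ, c (Fin.cons k m) * ∏ i, w i ^ m i) (fun t ht => by
          have h3 : ∀ k : ℕ, HasSum (fun m : Fin n → ℕ =>
              t ^ k * (c (Fin.cons k m) * ∏ i, w i ^ m i))
              (t ^ k * ∑' m : Fin n → ℕ, c (Fin.cons k m) * ∏ i, w i ^ m i) :=
            fun k => (hs w hw k).hasSum.mul_left _
          exact HasSum.prod_fiberwise (key t ht w hw) h3)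
      have h2 := congrFun h1 k
      simp only [Pi.zero_apply] at h2
      rw [← h2]
      exact (hs w hw k).hasSum
    funext m
    have := congrFun (hz (m 0)) (Fin.tail m)
    simpa using this

theorem HasSum.mul_of_prod {ι κ : Type*} {a : ι → ℂ} {b : κ → ℂ} {s t : ℂ} (ha : HasSum a s)
    (hb : HasSum b t) : HasSum (fun p : ι × κ => a p.1 * b p.2) (s * t) :=
  ha.mul hb (summable_mul_of_summable_norm ha.summable.norm hb.summable.norm)

theorem hasSum_prod_pi {n : ℕ} (f : Fin n → ℕ → ℂ) (s : Fin n → ℂ)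
    (h : ∀ i, HasSum (f i) (s i)) :
    HasSum (fun m : Fin n → ℕ => ∏ i, f i (m i)) (∏ i, s i) := by
  induction n with
  | zero => simp
  | succ n ih =>
    rw [← (Fin.consEquiv (fun _ : Fin (n + 1) => ℕ)).hasSum_iff, Fin.prod_univ_succ]
    refine ((h 0).mul_of_prod (ih _ _ fun i => h i.succ)).congr_fun fun p => ?_
    simp [Fin.consEquiv, Fin.prod_univ_succ]

/-! ### Orthonormal bases of reproducing kernel Hilbert spaces -/

/-- If the kernel of a reproducing kernel Hilbert space is `∑ₘ eₘ(x) ēₘ(y)` and the functions `eₘ`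
are independent in the `ℓ²` sense, then the `eₘ` form an orthonormal basis: the space is isometric
to `ℓ²`, an element being the sum of its coordinates times the `eₘ`. -/
theorem exists_linearIsometryEquiv_lp {ι X H : Type*} [NormedAddCommGroup H]
    [InnerProductSpace ℂ H] [CompleteSpace H] [RKHS ℂ H X ℂ] (e : ι → X → ℂ)
    (he : ∀ x y, HasSum (fun m => e m x * conj (e m y)) (RKHS.kernel H x y 1))
    (hindep : ∀ c : lp (fun _ : ι => ℂ) 2, (∀ x, HasSum (fun m => c m * e m x) 0) → c = 0) :
    ∃ V : H ≃ₗᵢ[ℂ] lp (fun _ : ι => ℂ) 2, ∀ (f : H) (x : X),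
      HasSum (fun m => V f m * e m x) (f x) := by
  let K : X → H := fun x => RKHS.kerFun H x 1
  have hmem : ∀ x, Memℓp (fun m => conj (e m x)) 2 := fun x => memℓp_gen (by
    refine (he x x).summable.norm.congr fun m => ?_
    simp [sq])
  let k : X → lp (fun _ : ι => ℂ) 2 := fun x => ⟨_, hmem x⟩
  have hkin : ∀ x (c : lp (fun _ : ι => ℂ) 2), HasSum (fun m => c m * e m x) ⟪k x, c⟫_ℂ := by
    intro x c
    refine (lp.hasSum_inner (k x) c).congr_fun fun m => ?_
    simp [k]
  have hkk : ∀ x y, ⟪k x, k y⟫_ℂ = ⟪K x, K y⟫_ℂ := by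
    intro x y
    have h1 : ⟪K x, K y⟫_ℂ = RKHS.kernel H x y 1 := by
      simp only [K, RKHS.kerFun_inner, RKHS.kerFun_apply]; simp
    rw [h1]
    refine (hkin x (k y)).unique ((he x y).congr_fun fun m => ?_)
    simp [k, mul_comm]
  let E : (X →₀ ℂ) →ₗ[ℂ] H := Finsupp.linearCombination ℂ K
  let g : (X →₀ ℂ) →ₗ[ℂ] lp (fun _ : ι => ℂ) 2 := Finsupp.linearCombination ℂ k
  have hdense : DenseRange E := by
    have := RKHS.kerFun_dense (𝕜 := ℂ) (X := X) (V := ℂ) H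
    rw [← Submodule.dense_iff_topologicalClosure_eq_top] at this
    refine this.mono ?_
    rw [← LinearMap.coe_range]
    simp only [SetLike.coe_subset_coe]
    refine Submodule.span_le.2 ?_
    rintro _ ⟨x, v, rfl⟩
    refine ⟨Finsupp.single x v, ?_⟩
    simp only [E, K, Finsupp.linearCombination_single]
    rw [← map_smul]; simp
  have hnorm : ∀ c, ‖g c‖ = ‖E c‖ := by
    intro c
    have h1 : ⟪g c, g c⟫_ℂ = ⟪E c, E c⟫_ℂ := by
      simp only [E, g, Finsupp.linearCombination_apply, Finsupp.sum, inner_smul_left,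
        inner_smul_right, sum_inner, inner_sum, hkk]
    rw [inner_self_eq_norm_sq_to_K, inner_self_eq_norm_sq_to_K] at h1
    exact (sq_eq_sq₀ (norm_nonneg _) (norm_nonneg _)).1 (by exact_mod_cast h1)
  let V : H →L[ℂ] lp (fun _ : ι => ℂ) 2 := g.extendOfNorm E
  have hVE : ∀ c, V (E c) = g c := fun c =>
    LinearMap.extendOfNorm_eq (f := g) hdense ⟨1, fun c => by rw [one_mul, hnorm]⟩ c
  have hVn : ∀ f, ‖V f‖ = ‖f‖ := fun f =>
    hdense.induction_on f (isClosed_eq (by fun_prop) (by fun_prop)) fun c => by rw [hVE, hnorm]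
  have hVK : ∀ x, V (K x) = k x := fun x => by
    have := hVE (Finsupp.single x 1)
    simpa [E, g] using this
  let L : H →ₗᵢ[ℂ] lp (fun _ : ι => ℂ) 2 := ⟨V.toLinearMap, hVn⟩
  have hLK : ∀ x, L (K x) = k x := hVK
  have hval : ∀ (f : H) x, HasSum (fun m => L f m * e m x) (f x) := by
    intro f x
    have h1 : f x = ⟪k x, L f⟫_ℂ := by
      rw [← hLK, L.inner_map_map]; simp [K]
    rw [h1]
    exact hkin x _
  have hsurj : Function.Surjective L := by
    rw [← LinearIsometry.coe_toLinearMap, ← LinearMap.range_eq_top]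
    have : CompleteSpace (LinearMap.range L.toLinearMap) :=
      (L.isometry.isUniformInducing.isComplete_range).completeSpace_coe
    rw [← Submodule.orthogonal_eq_bot_iff, Submodule.eq_bot_iff]
    intro c hc
    refine hindep c fun x => ?_
    have h1 : ⟪k x, c⟫_ℂ = 0 := by
      rw [← hLK]
      exact hc _ ⟨K x, rfl⟩
    rw [← h1]
    exact hkin x c
  exact ⟨LinearIsometryEquiv.ofSurjective L hsurj, hval⟩

/-! ### Taylor coefficients in the Bergman space of the polydisc -/

/-- `‖z^m‖²` in the space `𝔸^(λ)(𝔻ⁿ)`. -/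
noncomputable def monomialNormSq {n : ℕ} (lam : ℝ) (m : Fin n →₀ ℕ) : ℝ :=
  ∏ i, (binomCoeff lam (m i))⁻¹

theorem monomialNormSq_pos {n : ℕ} {lam : ℝ} (hl : 0 < lam) (m : Fin n →₀ ℕ) :
    0 < monomialNormSq lam m :=
  Finset.prod_pos fun _ _ => inv_pos.2 (binomCoeff_pos hl _)

theorem eq_zero_of_hasSum_finsupp_monomials {n : ℕ} (c : (Fin n →₀ ℕ) → ℂ)
    (h : ∀ z ∈ polydisc n, HasSum (fun m => c m * ∏ i, z i ^ m i) 0) : c = 0 := by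
  have h1 := eq_zero_of_hasSum_monomials_eq_zero
    (fun m => c (Finsupp.equivFunOnFinite.symm m)) fun z hz => by
      have := h z hz
      rw [← Finsupp.equivFunOnFinite.symm.hasSum_iff] at this
      exact this
  funext m
  simpa using congrFun h1 (Finsupp.equivFunOnFinite m)

namespace BergmanSpace
variable {n : ℕ} {lam : ℝ} [hl : Fact (0 < lam)]

variable (n lam) in
/-- The normalized monomials form an orthonormal basis of the Bergman space. -/
theorem exists_monomial_basis : ∃ V : BergmanSpace n lam ≃ₗᵢ[ℂ] lp (fun _ : Fin n →₀ ℕ => ℂ) 2,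
    ∀ (f : BergmanSpace n lam) (z : polydisc n),
      HasSum (fun m => V f m * ((√(monomialNormSq lam m) : ℂ)⁻¹ * ∏ i, z.1 i ^ m i)) (f z) := by
  refine exists_linearIsometryEquiv_lp
    (fun (m : Fin n →₀ ℕ) (z : polydisc n) => (√(monomialNormSq lam m) : ℂ)⁻¹ * ∏ i, z.1 i ^ m i)
    (fun z w => ?_) (fun c hc => ?_)
  · have h1 := hasSum_prod_pi (fun j k => (binomCoeff lam k : ℂ) * (z.1 j * conj (w.1 j)) ^ k) _
      fun j => hasSum_binomCoeff lam _ (norm_mul_conj_lt_one z w j)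
    rw [← Finsupp.equivFunOnFinite.hasSum_iff] at h1
    rw [RKHS.OfKernel.kernel_ofKernel]
    simp only [bergmanKernel, Matrix.of_apply, smul_apply, ContinuousLinearMap.id_apply,
      smul_eq_mul, mul_one]
    refine h1.congr_fun fun m => ?_
    have h2 : (√(monomialNormSq lam m) : ℂ)⁻¹ * (√(monomialNormSq lam m) : ℂ)⁻¹ =
        ∏ i, (binomCoeff lam (m i) : ℂ) := by
      rw [← mul_inv, ← Complex.ofReal_mul,
        Real.mul_self_sqrt (monomialNormSq_pos hl.out m).le, monomialNormSq]
      simp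
    simp only [map_mul, map_inv₀, Complex.conj_ofReal, map_prod, map_pow, Function.comp_apply,
      Finsupp.equivFunOnFinite_apply, mul_pow, Finset.prod_mul_distrib, ← h2]
    ring
  · have h1 := eq_zero_of_hasSum_finsupp_monomials
      (fun m => c m * (√(monomialNormSq lam m) : ℂ)⁻¹) fun z hz => by
        simpa only [mul_assoc] using hc ⟨z, hz⟩
    ext m
    have h2 := congrFun h1 m
    have h3 : (√(monomialNormSq lam m) : ℂ) ≠ 0 := by
      exact_mod_cast (Real.sqrt_pos.2 (monomialNormSq_pos hl.out m)).ne'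
    simpa [h3] using h2

/-- The Taylor coefficient of `f` at `z^m`. -/
noncomputable def coeff (f : BergmanSpace n lam) (m : Fin n →₀ ℕ) : ℂ :=
  (exists_monomial_basis n lam).choose f m * (√(monomialNormSq lam m) : ℂ)⁻¹

theorem hasSum_coeff (f : BergmanSpace n lam) (z : polydisc n) :
    HasSum (fun m => coeff f m * ∏ i, z.1 i ^ m i) (f z) := by
  simpa only [coeff, mul_assoc] using (exists_monomial_basis n lam).choose_spec f z

theorem coeff_eq_of_hasSum {f : BergmanSpace n lam} {c : (Fin n →₀ ℕ) → ℂ}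
    (h : ∀ z : polydisc n, HasSum (fun m => c m * ∏ i, z.1 i ^ m i) (f z)) : coeff f = c := by
  refine sub_eq_zero.1 (eq_zero_of_hasSum_finsupp_monomials _ fun z hz => ?_)
  have := (hasSum_coeff f ⟨z, hz⟩).sub (h ⟨z, hz⟩)
  rw [sub_self] at this
  exact this.congr_fun fun m => by simp [sub_mul]

theorem hasSum_inner (f g : BergmanSpace n lam) :
    HasSum (fun m => conj (coeff f m) * coeff g m * (monomialNormSq lam m : ℂ)) ⟪f, g⟫_ℂ := by
  rw [← (exists_monomial_basis n lam).choose.inner_map_map]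
  refine (lp.hasSum_inner _ _).congr_fun fun m => ?_
  have h1 := monomialNormSq_pos hl.out m
  have h3 : (√(monomialNormSq lam m) : ℂ) ≠ 0 := by
    exact_mod_cast (Real.sqrt_pos.2 h1).ne'
  have h2 : (monomialNormSq lam m : ℂ) = (√(monomialNormSq lam m) : ℂ) * √(monomialNormSq lam m) := by
    rw [← Complex.ofReal_mul, Real.mul_self_sqrt h1.le]
  rw [h2]
  simp only [coeff, map_mul, map_inv₀, Complex.conj_ofReal, RCLike.inner_apply]
  field_simp

/-- A polynomial, as an element of the Bergman space. -/
noncomputable def ofPoly (p : MvPolynomial (Fin n) ℂ) : BergmanSpace n lam :=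
  (exists_mul n lam p).choose (RKHS.kerFun _ (⟨0, fun _ => by simp⟩ : polydisc n) 1)

theorem ofPoly_apply (p : MvPolynomial (Fin n) ℂ) (z : polydisc n) :
    (ofPoly p : BergmanSpace n lam) z = MvPolynomial.eval z.1 p := by
  rw [ofPoly, (exists_mul n lam p).choose_spec, RKHS.kerFun_apply, RKHS.OfKernel.kernel_ofKernel]
  simp [bergmanKernel]

theorem coeff_ofPoly (p : MvPolynomial (Fin n) ℂ) (m : Fin n →₀ ℕ) :
    coeff (ofPoly p : BergmanSpace n lam) m = p.coeff m := by
  refine congrFun (coeff_eq_of_hasSum (c := fun m => p.coeff m) fun z => ?_) m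
  rw [ofPoly_apply, MvPolynomial.eval_eq']
  refine hasSum_sum_of_ne_finset_zero fun m hm => ?_
  rw [MvPolynomial.notMem_support_iff.1 hm, zero_mul]

theorem inner_ofPoly_left (p : MvPolynomial (Fin n) ℂ) (f : BergmanSpace n lam) :
    ⟪ofPoly p, f⟫_ℂ =
      ∑ m ∈ p.support, conj (p.coeff m) * coeff f m * (monomialNormSq lam m : ℂ) := by
  refine (hasSum_inner _ f).unique ?_
  simp only [coeff_ofPoly]
  refine hasSum_sum_of_ne_finset_zero fun m hm => ?_
  rw [MvPolynomial.notMem_support_iff.1 hm, map_zero, zero_mul, zero_mul]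

end BergmanSpace

/-! ### Norms of alternants -/

/-- The squared norm of a polynomial when distinct monomials are orthogonal and the monomial `z^d`
has squared norm `∏ᵢ c (dᵢ)`. -/
noncomputable def diagNormSq {n : ℕ} (c : ℕ → ℝ) (p : MvPolynomial (Fin n) ℂ) : ℝ :=
  ∑ d ∈ p.support, ‖p.coeff d‖ ^ 2 * ∏ i, c (d i)

theorem diagNormSq_eq_sum {n : ℕ} (c : ℕ → ℝ) (p : MvPolynomial (Fin n) ℂ)
    {s : Finset (Fin n →₀ ℕ)} (hs : p.support ⊆ s) :
    diagNormSq c p = ∑ d ∈ s, ‖p.coeff d‖ ^ 2 * ∏ i, c (d i) :=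
  Finset.sum_subset hs fun d _ hd => by simp [MvPolynomial.notMem_support_iff.1 hd]

theorem diagNormSq_C_mul {n : ℕ} (c : ℕ → ℝ) (a : ℂ) (p : MvPolynomial (Fin n) ℂ) :
    diagNormSq c (MvPolynomial.C a * p) = ‖a‖ ^ 2 * diagNormSq c p := by
  rw [diagNormSq_eq_sum c (MvPolynomial.C a * p) (s := p.support), diagNormSq, Finset.mul_sum]
  · simp only [MvPolynomial.coeff_C_mul, norm_mul, mul_pow, mul_assoc]
  · intro d
    simp only [MvPolynomial.mem_support_iff, MvPolynomial.coeff_C_mul]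
    exact fun h => right_ne_zero_of_mul h

theorem diagNormSq_sum_monomial {n : ℕ} {κ : Type*} [Fintype κ] (c : ℕ → ℝ)
    (g : κ → Fin n →₀ ℕ) (hg : Function.Injective g) (a : κ → ℂ) :
    diagNormSq c (∑ k, MvPolynomial.monomial (g k) (a k)) =
      ∑ k, ‖a k‖ ^ 2 * ∏ i, c (g k i) := by
  classical
  rw [diagNormSq_eq_sum c _ (s := Finset.univ.image g), Finset.sum_image hg.injOn]
  · refine Finset.sum_congr rfl fun k _ => ?_
    rw [MvPolynomial.coeff_sum, Finset.sum_eq_single k]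
    · simp
    · intro j _ hj
      simp [MvPolynomial.coeff_monomial, hg.ne hj]
    · simp
  · intro d hd
    rw [MvPolynomial.mem_support_iff, MvPolynomial.coeff_sum] at hd
    obtain ⟨k, -, hk⟩ := Finset.exists_ne_zero_of_sum_ne_zero hd
    rw [MvPolynomial.coeff_monomial] at hk
    exact Finset.mem_image.2 ⟨k, Finset.mem_univ _, by_contra fun h => hk (if_neg h)⟩

/-- The alternant `det (zᵢ ^ mⱼ)`. -/
noncomputable def alternant {n : ℕ} (m : Fin n → ℕ) : MvPolynomial (Fin n) ℂ :=
  (Matrix.of fun i j => (MvPolynomial.X i : MvPolynomial (Fin n) ℂ) ^ m j).det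

theorem alternant_eq_sum_prod {n : ℕ} (m : Fin n → ℕ) : alternant m =
    ∑ σ : Equiv.Perm (Fin n), Equiv.Perm.sign σ • ∏ j, MvPolynomial.X (σ j) ^ m j := by
  simp [alternant, Matrix.det_apply]

theorem alternant_eq_sum_monomial {n : ℕ} (m : Fin n → ℕ) : alternant m =
    ∑ σ : Equiv.Perm (Fin n),
      MvPolynomial.monomial (Finsupp.equivMapDomain σ (Finsupp.equivFunOnFinite.symm m))
        ((Equiv.Perm.sign σ : ℤ) : ℂ) := by
  rw [alternant_eq_sum_prod]
  refine Finset.sum_congr rfl fun σ _ => ?_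
  rw [MvPolynomial.monomial_eq, Finsupp.prod_fintype _ _ (by simp),
    ← Equiv.prod_comp σ (fun i => MvPolynomial.X i ^ _)]
  simp [Units.smul_def]

theorem diagNormSq_alternant {n : ℕ} (c : ℕ → ℝ) (m : Fin n → ℕ) (hm : Function.Injective m) :
    diagNormSq c (alternant m) = n.factorial * ∏ i, c (m i) := by
  rw [alternant_eq_sum_monomial, diagNormSq_sum_monomial]
  · have h1 : ∀ σ : Equiv.Perm (Fin n), ‖((Equiv.Perm.sign σ : ℤ) : ℂ)‖ = 1 := fun σ => by
      rcases Int.units_eq_one_or (Equiv.Perm.sign σ) with h | h <;> simp [h]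
    have h2 : ∀ σ : Equiv.Perm (Fin n),
        ∏ i, c (Finsupp.equivMapDomain σ (Finsupp.equivFunOnFinite.symm m) i) = ∏ i, c (m i) := by
      intro σ
      rw [← Equiv.prod_comp σ]
      simp
    simp only [h1, h2]
    simp [Fintype.card_perm]
  · intro σ τ h
    ext i : 1
    have h1 := DFunLike.congr_fun h (τ i)
    simp only [Finsupp.equivMapDomain_apply, Finsupp.equivFunOnFinite_symm_apply_apply,
      Equiv.symm_apply_apply] at h1
    have h2 := congrArg σ (hm h1)
    rw [Equiv.apply_symm_apply] at h2
    exact h2.symm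

theorem sum_X_mul_alternant {n : ℕ} (m : Fin n → ℕ) :
    (∑ i, MvPolynomial.X i) * alternant m =
      ∑ k, alternant (Function.update m k (m k + 1)) := by
  simp only [alternant_eq_sum_prod]
  rw [Finset.sum_comm, Finset.mul_sum]
  refine Finset.sum_congr rfl fun σ _ => ?_
  rw [← Equiv.sum_comp σ, Finset.sum_mul]
  refine Finset.sum_congr rfl fun k _ => ?_
  rw [mul_smul_comm, ← Finset.mul_prod_erase _ _ (Finset.mem_univ k),
    ← Finset.mul_prod_erase _ _ (Finset.mem_univ k), Function.update_self, pow_succ']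
  congr 1
  rw [mul_assoc]
  congr 2
  refine Finset.prod_congr rfl fun j hj => ?_
  rw [Function.update_of_ne (Finset.ne_of_mem_erase hj)]

theorem alternant_eq_zero {n : ℕ} {m : Fin n → ℕ} {i j : Fin n} (hij : i ≠ j) (h : m i = m j) :
    alternant m = 0 :=
  Matrix.det_zero_of_column_eq hij fun k => by simp [h]

/-- Pieri's rule for the Vandermonde determinant: all terms but one have two equal exponents. -/
theorem sum_X_mul_alternant_val (k : ℕ) :
    (∑ i, MvPolynomial.X i) * alternant (fun j : Fin (k + 1) => (j : ℕ)) =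
      alternant (Function.update (fun j : Fin (k + 1) => (j : ℕ)) (Fin.last k) (k + 1)) := by
  rw [sum_X_mul_alternant, Fin.sum_univ_castSucc, Finset.sum_eq_zero, zero_add]
  · simp
  · intro i _
    refine alternant_eq_zero (i := i.castSucc) (j := i.succ) (Fin.castSucc_lt_succ).ne ?_
    rw [Function.update_self, Function.update_of_ne (Fin.castSucc_lt_succ).ne']
    simp

/-- The ratio of the norms of `(z₁ + ⋯ + zₙ) J_s` and `J_s`: in passing from the exponents
`0, …, n - 1` to `0, …, n - 2, n` the factor `c (n - 1)` is replaced by `c n`. -/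
theorem diagNormSq_sum_X_mul_alternant {n : ℕ} (hn : n ≠ 0) (lam : ℝ) (c : ℕ → ℝ)
    (hc : ∀ k : ℕ, (lam + k) * c (k + 1) = (k + 1) * c k) :
    (lam + n - 1) * diagNormSq c ((∑ i, MvPolynomial.X i) * alternant (fun j : Fin n => (j : ℕ))) =
      n * diagNormSq c (alternant (fun j : Fin n => (j : ℕ))) := by
  obtain ⟨k, rfl⟩ := Nat.exists_eq_succ_of_ne_zero hn
  rw [sum_X_mul_alternant_val, diagNormSq_alternant, diagNormSq_alternant]
  · rw [Fin.prod_univ_castSucc, Fin.prod_univ_castSucc, Function.update_self]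
    have h1 : ∀ i : Fin k, Function.update (fun j : Fin (k + 1) => (j : ℕ)) (Fin.last k) (k + 1)
        i.castSucc = i := fun i => by
      rw [Function.update_of_ne (Fin.castSucc_lt_last i).ne]; simp
    simp only [h1, Fin.val_castSucc, Fin.val_last]
    push_cast
    linear_combination ((k + 1).factorial * ∏ i : Fin k, c i) * hc k
  · exact Fin.val_injective
  · intro i j h
    simp only [Function.update_apply] at h
    split_ifs at h with h1 h2 h2 <;> omega

theorem exists_jacobian_eq (n : ℕ) : ∃ ε : ℂ, ε ≠ 0 ∧
    jacobian n = MvPolynomial.C ε * alternant (fun j : Fin n => (j : ℕ)) := by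
  refine ⟨∏ i : Fin n, ∏ _j ∈ Finset.Ioi i, (-1), ?_, ?_⟩
  · simp [Finset.prod_ne_zero_iff]
  · have h1 : alternant (fun j : Fin n => (j : ℕ)) =
        (Matrix.vandermonde (MvPolynomial.X : Fin n → MvPolynomial (Fin n) ℂ)).det := rfl
    rw [h1, Matrix.det_vandermonde, jacobian]
    simp only [map_prod, ← Finset.prod_mul_distrib]
    refine Finset.prod_congr rfl fun i _ => Finset.prod_congr rfl fun j _ => ?_
    simp

theorem diagNormSq_sum_X {n : ℕ} (c : ℕ → ℝ) (h0 : c 0 = 1) :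
    diagNormSq c (∑ i : Fin n, MvPolynomial.X i) = n * c 1 := by
  have h := diagNormSq_sum_monomial c (fun i : Fin n => Finsupp.single i 1)
    (Finsupp.single_left_injective one_ne_zero) (fun _ => 1)
  refine h.trans ?_
  have h1 : ∀ k : Fin n, ∏ i, c (Finsupp.single k 1 i) = c 1 := fun k => by
    rw [Finset.prod_eq_single k] <;> simp +contextual [h0, eq_comm]
  simp [h1]

/-- Distinct exponents below `0, 1, …, n - 1` are equal to them. -/
theorem eq_val_of_injective_of_le {n : ℕ} {b : Fin n → ℕ} (hb : Function.Injective b)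
    (hle : ∀ i, b i ≤ i) (i : Fin n) : b i = i := by
  induction i using WellFoundedLT.induction with
  | ind i ih =>
    by_contra h
    have h1 : b i < i := lt_of_le_of_ne (hle i) h
    have h2 := ih ⟨b i, h1.trans i.2⟩ h1
    exact h1.ne (congrArg Fin.val (hb h2))

/-! ### Symmetric and antisymmetric functions -/

namespace BergmanSpace
variable {n : ℕ} {lam : ℝ} [hl : Fact (0 < lam)]

theorem norm_ofPoly_sq (p : MvPolynomial (Fin n) ℂ) : ‖(ofPoly p : BergmanSpace n lam)‖ ^ 2 =
    diagNormSq (fun k => (binomCoeff lam k)⁻¹) p := by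
  have h := inner_ofPoly_left p (ofPoly p : BergmanSpace n lam)
  rw [inner_self_eq_norm_sq_to_K] at h
  simp only [coeff_ofPoly, Complex.conj_mul', monomialNormSq] at h
  apply Complex.ofReal_injective
  rw [diagNormSq]
  push_cast at h ⊢
  exact h

theorem coeff_equivMapDomain {f : BergmanSpace n lam} {σ : Equiv.Perm (Fin n)} {c : ℂ}
    (h : ∀ z : polydisc n, f (permPolydisc σ⁻¹ z) = c * f z) (m : Fin n →₀ ℕ) :
    coeff f m = c * coeff f (Finsupp.equivMapDomain σ m) := by
  let E : (Fin n →₀ ℕ) ≃ (Fin n →₀ ℕ) := Finsupp.equivCongrLeft σ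
  have hE : ∀ m, E m = Finsupp.equivMapDomain σ m := fun _ => rfl
  have hEs : ∀ m, E.symm (Finsupp.equivMapDomain σ m) = m := E.symm_apply_apply
  have hcf : ∀ z : polydisc n, (c • f) z = c * f z := fun z => by simp
  have h1 : coeff (c • f) = fun m => coeff f (E.symm m) := by
    refine coeff_eq_of_hasSum fun z => ?_
    have h2 := hasSum_coeff f (permPolydisc σ⁻¹ z)
    rw [h] at h2
    rw [hcf, ← E.hasSum_iff]
    refine h2.congr_fun fun m => ?_
    simp only [Function.comp_apply, hE, hEs]
    rw [← Equiv.prod_comp σ]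
    simp [permPolydisc]
  have h2 : coeff (c • f) = fun m => c * coeff f m := by
    refine coeff_eq_of_hasSum fun z => ?_
    rw [hcf]
    exact ((hasSum_coeff f z).mul_left c).congr_fun fun m => by ring
  have h3 := congrFun (h1.symm.trans h2) (E m)
  simpa only [hE, hEs] using h3

/-- A symmetric function orthogonal to all symmetric polynomials without constant term is constant. -/
theorem coeff_eq_zero_of_mem_symPart {f : BergmanSpace n lam} (hf : f ∈ symPart n lam)
    (h : ∀ p : SymPoly n, MvPolynomial.constantCoeff p.1 = 0 → ⟪ofPoly p.1, f⟫_ℂ = 0)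
    {m : Fin n →₀ ℕ} (hm : m ≠ 0) : coeff f m = 0 := by
  -- Test against the sum of all permutations of the monomial `z^m`.
  let q : MvPolynomial (Fin n) ℂ :=
    ∑ σ : Equiv.Perm (Fin n), MvPolynomial.monomial (Finsupp.equivMapDomain σ m) 1
  have hq : q.IsSymmetric := by
    intro τ
    simp only [q, map_sum, MvPolynomial.rename_monomial]
    refine Fintype.sum_equiv (Equiv.mulLeft τ) _ _ fun σ => ?_
    congr 2
    rw [← Finsupp.equivMapDomain_eq_mapDomain, ← Finsupp.equivMapDomain_trans]
    rfl
  have hne : ∀ σ : Equiv.Perm (Fin n), Finsupp.equivMapDomain σ m ≠ 0 := by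
    intro σ h0
    refine hm (Finsupp.ext fun i => ?_)
    simpa using DFunLike.congr_fun h0 (σ i)
  have h1 := h ⟨q, hq⟩ (by simp [q, MvPolynomial.constantCoeff_monomial, hne])
  rw [inner_ofPoly_left] at h1
  have h2 : ∀ d ∈ q.support, conj (q.coeff d) * coeff f d * (monomialNormSq lam d : ℂ) =
      conj (q.coeff d) * (coeff f m * (monomialNormSq lam m : ℂ)) := by
    intro d hd
    rw [MvPolynomial.mem_support_iff, MvPolynomial.coeff_sum] at hd
    obtain ⟨σ, -, hσ⟩ := Finset.exists_ne_zero_of_sum_ne_zero hd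
    rw [MvPolynomial.coeff_monomial] at hσ
    obtain rfl : Finsupp.equivMapDomain σ m = d := by_contra fun h => hσ (if_neg h)
    have h3 : monomialNormSq lam (Finsupp.equivMapDomain σ m) = monomialNormSq lam m := by
      rw [monomialNormSq, ← Equiv.prod_comp σ]
      simp [monomialNormSq]
    rw [h3, coeff_equivMapDomain (σ := σ) (c := 1) (fun z => by rw [one_mul]; exact hf σ z) m,
      one_mul, mul_assoc]
  have h4 : ∑ d ∈ q.support, q.coeff d = n.factorial := by
    have h5 := MvPolynomial.eval_eq' (fun _ : Fin n => (1 : ℂ)) q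
    simp only [one_pow, Finset.prod_const_one, mul_one] at h5
    rw [← h5]
    simp [q, MvPolynomial.eval_monomial, Fintype.card_perm]
  rw [Finset.sum_congr rfl h2, ← Finset.sum_mul, ← map_sum, h4] at h1
  have h6 : (monomialNormSq lam m : ℂ) ≠ 0 := by
    exact_mod_cast (monomialNormSq_pos hl.out m).ne'
  simpa [Nat.factorial_ne_zero, h6] using h1

theorem coeff_eq_zero_of_mem_antiPart {f : BergmanSpace n lam} (hf : f ∈ antiPart n lam)
    {m : Fin n →₀ ℕ} {i j : Fin n} (hij : i ≠ j) (h : m i = m j) : coeff f m = 0 := by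
  have h1 := coeff_equivMapDomain (hf (Equiv.swap i j)) m
  have h2 : Finsupp.equivMapDomain (Equiv.swap i j) m = m := by
    ext k
    rw [Finsupp.equivMapDomain_apply, Equiv.symm_swap, Equiv.swap_apply_def]
    split_ifs with h3 h4 <;> simp [*]
  rw [h2, Equiv.Perm.sign_swap hij] at h1
  push_cast at h1
  linear_combination h1 / 2

theorem coeff_mul {f g : BergmanSpace n lam} {p : MvPolynomial (Fin n) ℂ}
    (h : ∀ z : polydisc n, g z = MvPolynomial.eval z.1 p * f z) (m : Fin n →₀ ℕ) :
    coeff g m = ∑ d ∈ p.support, if d ≤ m then p.coeff d * coeff f (m - d) else 0 := by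
  refine congrFun (coeff_eq_of_hasSum (c := fun m =>
    ∑ d ∈ p.support, if d ≤ m then p.coeff d * coeff f (m - d) else 0) fun z => ?_) m
  rw [h, MvPolynomial.eval_eq', Finset.sum_mul]
  simp only [Finset.sum_mul]
  refine hasSum_sum fun d _ => ?_
  rw [← (add_left_injective d).hasSum_iff]
  · refine ((hasSum_coeff f z).mul_left (p.coeff d * ∏ i, z.1 i ^ d i)).congr_fun fun k => ?_
    simp only [Function.comp_apply, le_add_iff_nonneg_left, zero_le, if_true,
      add_tsub_cancel_right, Finsupp.add_apply, pow_add, Finset.prod_mul_distrib]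
    ring
  · intro k hk
    rw [if_neg, zero_mul]
    exact fun hd => hk ⟨k - d, tsub_add_cancel_of_le hd⟩

/-- The monomials of the Vandermonde determinant have the lowest degree possible for distinct
exponents, hence it is orthogonal to the multiples of antisymmetric functions by polynomials without
constant term. -/
theorem inner_jacobian_eq_zero {f g : BergmanSpace n lam} (hf : f ∈ antiPart n lam)
    {p : MvPolynomial (Fin n) ℂ} (hp : MvPolynomial.constantCoeff p = 0)
    (h : ∀ z : polydisc n, g z = MvPolynomial.eval z.1 p * f z) :
    ⟪ofPoly (alternant (fun j : Fin n => (j : ℕ))), g⟫_ℂ = 0 := by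
  rw [inner_ofPoly_left]
  refine Finset.sum_eq_zero fun m hm => ?_
  obtain ⟨σ, rfl⟩ : ∃ σ : Equiv.Perm (Fin n), Finsupp.equivMapDomain σ
      (Finsupp.equivFunOnFinite.symm fun j : Fin n => (j : ℕ)) = m := by
    rw [alternant_eq_sum_monomial, MvPolynomial.mem_support_iff, MvPolynomial.coeff_sum] at hm
    obtain ⟨σ, -, hσ⟩ := Finset.exists_ne_zero_of_sum_ne_zero hm
    rw [MvPolynomial.coeff_monomial] at hσ
    exact ⟨σ, by_contra fun h => hσ (if_neg h)⟩
  rw [coeff_mul h, Finset.sum_eq_zero, mul_zero, zero_mul]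
  intro d hd
  split_ifs with hle
  swap
  · rfl
  set m := Finsupp.equivMapDomain σ (Finsupp.equivFunOnFinite.symm fun j : Fin n => (j : ℕ)) with hmdef
  -- If `m - d` has a repeated entry, the coefficient of `f` vanishes; otherwise `d = 0`.
  by_cases hinj : Function.Injective (m - d)
  · have h1 := eq_val_of_injective_of_le (b := fun i => (m - d) (σ i))
      (hinj.comp σ.injective) fun i => by
        simp [hmdef]
    have h2 : d = 0 := by
      ext i
      have h3 := h1 (σ.symm i)
      have h4 := hle i
      simp only [hmdef, Equiv.apply_symm_apply, Finsupp.tsub_apply, Finsupp.equivMapDomain_apply,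
        Finsupp.equivFunOnFinite_symm_apply_apply] at h3 h4
      rw [Finsupp.zero_apply]
      omega
    rw [h2, ← MvPolynomial.constantCoeff_eq, hp, zero_mul]
  · simp only [Function.Injective, not_forall] at hinj
    obtain ⟨i, j, h1, h2⟩ := hinj
    rw [coeff_eq_zero_of_mem_antiPart hf h2 h1, mul_zero]

end BergmanSpace

/-! ### Comparison of Hilbert modules -/

/-- The power sum `z₁ + ⋯ + zₙ`. -/
noncomputable def sumX (n : ℕ) : SymPoly n :=
  ⟨∑ i, MvPolynomial.X i, by simpa [MvPolynomial.psum] using MvPolynomial.psum_isSymmetric (Fin n) ℂ 1⟩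

theorem UnitarilyEquivalent.symm {R H H' : Type*} [CommRing R] [Algebra ℂ R]
    [NormedAddCommGroup H] [InnerProductSpace ℂ H]
    [NormedAddCommGroup H'] [InnerProductSpace ℂ H']
    {T : R →ₐ[ℂ] (H →L[ℂ] H)} {T' : R →ₐ[ℂ] (H' →L[ℂ] H')} (h : UnitarilyEquivalent T T') :
    UnitarilyEquivalent T' T := by
  obtain ⟨U, hU⟩ := h
  exact ⟨U.symm, fun r x => by rw [U.symm_apply_eq, hU, U.apply_symm_apply]⟩

section comparison
variable {n : ℕ} {lam : ℝ} [hl : Fact (0 < lam)]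

theorem inv_binomCoeff_succ (lam : ℝ) [hl : Fact (0 < lam)] (k : ℕ) :
    (lam + k) * (binomCoeff lam (k + 1))⁻¹ = (k + 1) * (binomCoeff lam k)⁻¹ := by
  have h := binomCoeff_succ lam k
  have h1 := (binomCoeff_pos hl.out k).ne'
  have h2 := (binomCoeff_pos hl.out (k + 1)).ne'
  field_simp
  linarith

/-- A module `Y` of symmetric functions containing the constants is not equivalent to a module `X`
with a vector `v` that is orthogonal to the multiples of all vectors by symmetric polynomials
without constant term, if the norm of `(z₁ + ⋯ + zₙ) v` is as for the Vandermonde determinant: a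
unitary would take `v` to a constant, and for these the norm is a different one. -/
theorem not_unitarilyEquivalent_of_orthogonal {X Y : Type*} [NormedAddCommGroup X]
    [InnerProductSpace ℂ X] [NormedAddCommGroup Y] [InnerProductSpace ℂ Y] (hn : 2 ≤ n)
    {T : SymPoly n →ₐ[ℂ] (X →L[ℂ] X)} {S : SymPoly n →ₐ[ℂ] (Y →L[ℂ] Y)}
    {v : X} (hv : v ≠ 0)
    (hvT : ∀ (p : SymPoly n) (x : X), MvPolynomial.constantCoeff p.1 = 0 → ⟪v, T p x⟫_ℂ = 0)
    (hvn : (lam + n - 1) * ‖T (sumX n) v‖ ^ 2 = n * ‖v‖ ^ 2)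
    (ι : Y →ₗᵢ[ℂ] BergmanSpace n lam)
    (hι : ∀ (p : SymPoly n) (y : Y) (z : polydisc n), ι (S p y) z = MvPolynomial.eval z.1 p.1 * ι y z)
    (hsym : ∀ y, ι y ∈ symPart n lam) {y₁ : Y} (hy₁ : ∀ z, ι y₁ z = 1) :
    ¬ UnitarilyEquivalent T S := by
  rintro ⟨U, hU⟩
  set f := ι (U v) with hf
  have h1 : ∀ p : SymPoly n, ι (S p y₁) = BergmanSpace.ofPoly p.1 := fun p => RKHS.ext fun z => by
    rw [hι, hy₁, mul_one, BergmanSpace.ofPoly_apply]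
  have horth : ∀ p : SymPoly n, MvPolynomial.constantCoeff p.1 = 0 →
      ⟪BergmanSpace.ofPoly p.1, f⟫_ℂ = 0 := by
    intro p hp
    have h2 : S p y₁ = U (T p (U.symm y₁)) := by rw [hU, U.apply_symm_apply]
    rw [inner_eq_zero_symm, ← h1, hf, ι.inner_map_map, h2, U.inner_map_map]
    exact hvT p _ hp
  have hconst : ∀ z, f z = BergmanSpace.coeff f 0 := by
    intro z
    have h2 := hasSum_single (f := fun m => BergmanSpace.coeff f m * ∏ i, z.1 i ^ m i) 0
      fun m hm => by
        rw [BergmanSpace.coeff_eq_zero_of_mem_symPart (hsym _) horth hm, zero_mul]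
    rw [(BergmanSpace.hasSum_coeff f z).unique h2]
    simp
  generalize BergmanSpace.coeff f 0 = a at hconst
  have hfa : f = BergmanSpace.ofPoly (MvPolynomial.C a * 1) := RKHS.ext fun z => by
    rw [hconst, BergmanSpace.ofPoly_apply]; simp
  have hfe : ι (U (T (sumX n) v)) = BergmanSpace.ofPoly (MvPolynomial.C a * (sumX n).1) :=
    RKHS.ext fun z => by
      rw [hU, hι, ← hf, hconst, BergmanSpace.ofPoly_apply]; simp [mul_comm]
  have hb0 : (binomCoeff lam 0)⁻¹ = 1 := by simp [binomCoeff]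
  have hv2 : ‖v‖ ^ 2 = ‖a‖ ^ 2 := by
    rw [← U.norm_map v, ← ι.norm_map (U v), ← hf, hfa, BergmanSpace.norm_ofPoly_sq,
      diagNormSq_C_mul]
    have := diagNormSq_sum_monomial (fun k => (binomCoeff lam k)⁻¹)
      (fun _ : Unit => (0 : Fin n →₀ ℕ)) (fun _ _ _ => rfl) (fun _ => 1)
    simp only [Finset.univ_unique, Finset.sum_singleton, Finsupp.zero_apply, hb0] at this
    rw [MvPolynomial.monomial_zero', map_one] at this
    simp [this]
  have he2 : ‖T (sumX n) v‖ ^ 2 = ‖a‖ ^ 2 * (n * (binomCoeff lam 1)⁻¹) := by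
    rw [← U.norm_map (T _ v), ← ι.norm_map (U _), hfe, BergmanSpace.norm_ofPoly_sq,
      diagNormSq_C_mul, ← diagNormSq_sum_X (fun k => (binomCoeff lam k)⁻¹) hb0]
    rfl
  have hb1 := inv_binomCoeff_succ lam 0
  rw [hb0] at hb1
  simp only [Nat.cast_zero, add_zero, zero_add, mul_one] at hb1
  have ha : 0 < ‖a‖ ^ 2 := by rw [← hv2]; positivity
  rw [he2, hv2] at hvn
  have hn' : (2 : ℝ) ≤ n := by exact_mod_cast hn
  have h3 : (lam + n - 1) * (binomCoeff lam 1)⁻¹ = 1 := by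
    have h4 : ‖a‖ ^ 2 * n ≠ 0 := by positivity
    apply mul_left_cancel₀ h4
    linear_combination hvn
  have h5 : 0 < (binomCoeff lam 1)⁻¹ := inv_pos.2 (binomCoeff_pos hl.out 1)
  nlinarith

/-- A module of symmetric functions containing the constants is not equivalent to a module of
antisymmetric functions containing a multiple of the Vandermonde determinant. -/
theorem not_unitarilyEquivalent_of_antiPart {X Y : Type*} [NormedAddCommGroup X]
    [InnerProductSpace ℂ X] [NormedAddCommGroup Y] [InnerProductSpace ℂ Y] (hn : 2 ≤ n)
    {T : SymPoly n →ₐ[ℂ] (X →L[ℂ] X)} {S : SymPoly n →ₐ[ℂ] (Y →L[ℂ] Y)}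
    (κ : X →ₗᵢ[ℂ] BergmanSpace n lam)
    (hκ : ∀ (p : SymPoly n) (x : X) (z : polydisc n), κ (T p x) z = MvPolynomial.eval z.1 p.1 * κ x z)
    (hanti : ∀ x, κ x ∈ antiPart n lam) {v : X} {c : ℂ} (hc : c ≠ 0)
    (hv : ∀ z : polydisc n, κ v z = c * MvPolynomial.eval z.1 (jacobian n))
    (ι : Y →ₗᵢ[ℂ] BergmanSpace n lam)
    (hι : ∀ (p : SymPoly n) (y : Y) (z : polydisc n), ι (S p y) z = MvPolynomial.eval z.1 p.1 * ι y z)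
    (hsym : ∀ y, ι y ∈ symPart n lam) {y₁ : Y} (hy₁ : ∀ z, ι y₁ z = 1) :
    ¬ UnitarilyEquivalent T S := by
  obtain ⟨ε, hε, hJ⟩ := exists_jacobian_eq n
  set D : MvPolynomial (Fin n) ℂ := alternant (fun j : Fin n => (j : ℕ)) with hD
  have hκv : κ v = (c * ε) • BergmanSpace.ofPoly D := RKHS.ext fun z => by
    rw [hv, hJ]
    simp [BergmanSpace.ofPoly_apply, mul_assoc]
  have hκe : κ (T (sumX n) v) = (c * ε) • BergmanSpace.ofPoly ((∑ i, MvPolynomial.X i) * D) :=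
    RKHS.ext fun z => by
      rw [hκ, hκv]
      simp [BergmanSpace.ofPoly_apply, sumX, mul_left_comm]
  refine not_unitarilyEquivalent_of_orthogonal hn (v := v) ?_ ?_ ?_ ι hι hsym hy₁
  · rintro rfl
    have h1 : ‖κ 0‖ ^ 2 = 0 := by simp
    rw [hκv, norm_smul, mul_pow, BergmanSpace.norm_ofPoly_sq,
      diagNormSq_alternant _ _ Fin.val_injective] at h1
    have h2 : 0 < ∏ i : Fin n, (binomCoeff lam i)⁻¹ :=
      Finset.prod_pos fun i _ => inv_pos.2 (binomCoeff_pos hl.out _)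
    have h3 : 0 < ‖c * ε‖ := norm_pos_iff.2 (mul_ne_zero hc hε)
    have : 0 < ‖c * ε‖ ^ 2 * (n.factorial * ∏ i : Fin n, (binomCoeff lam i)⁻¹) := by positivity
    exact this.ne' h1
  · intro p x hp
    rw [← κ.inner_map_map, hκv, inner_smul_left,
      BergmanSpace.inner_jacobian_eq_zero (hanti x) hp (hκ p x), mul_zero]
  · have h1 := diagNormSq_sum_X_mul_alternant (n := n) (by omega) lam
      (fun k => (binomCoeff lam k)⁻¹) (inv_binomCoeff_succ lam)
    rw [← BergmanSpace.norm_ofPoly_sq, ← BergmanSpace.norm_ofPoly_sq] at h1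
    rw [← κ.norm_map, ← κ.norm_map v, hκv, hκe, norm_smul, norm_smul, mul_pow, mul_pow]
    linear_combination ‖c * ε‖ ^ 2 * h1

theorem eval_jacobian_permPolydisc (σ : Equiv.Perm (Fin n)) (z : polydisc n) :
    MvPolynomial.eval (permPolydisc σ⁻¹ z).1 (jacobian n) =
      ((Equiv.Perm.sign σ : ℤ) : ℂ) * MvPolynomial.eval z.1 (jacobian n) := by
  obtain ⟨ε, -, hJ⟩ := exists_jacobian_eq n
  have h1 : ∀ w : Fin n → ℂ, MvPolynomial.eval w (alternant (fun j : Fin n => (j : ℕ))) =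
      (Matrix.of fun i j : Fin n => w i ^ (j : ℕ)).det := by
    intro w
    rw [alternant, RingHom.map_det]
    congr 1
    ext i j
    simp
  rw [hJ, map_mul, map_mul, h1, h1, ← mul_assoc, mul_comm _ (MvPolynomial.eval _ _), mul_assoc]
  congr 1
  · simp
  · exact Matrix.det_permute σ (Matrix.of fun i j : Fin n => z.1 i ^ (j : ℕ))

end comparison

/-! ### The function modules on the polydisc and the symmetrized polydisc -/

namespace WeightedPullbackSpace
variable {n : ℕ} {lam : ℝ} [Fact (0 < lam)] {ρ : MvPolynomial (Fin n) ℂ} [NeZero ρ]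

variable (n lam ρ) in
/-- The isometry `g ↦ ρ · (g ∘ s)` into the Bergman space of the polydisc. -/
noncomputable def liftₗᵢ : WeightedPullbackSpace n lam ρ →ₗᵢ[ℂ] BergmanSpace n lam :=
  ⟨lift, fun _ => rfl⟩

theorem liftₗᵢ_apply (g : WeightedPullbackSpace n lam ρ) (z : polydisc n) :
    liftₗᵢ n lam ρ g z = MvPolynomial.eval z.1 ρ * toFun g (toSymm z) := lift_apply g z

theorem liftₗᵢ_action (p : SymPoly n) (g : WeightedPullbackSpace n lam ρ) (z : polydisc n) :
    liftₗᵢ n lam ρ (action p g) z = MvPolynomial.eval z.1 p.1 * liftₗᵢ n lam ρ g z := by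
  rw [liftₗᵢ_apply, liftₗᵢ_apply, action_apply, toSymm, symmValue_symmetrization, mul_left_comm]

variable (n lam ρ) in
/-- The constant function `1`. -/
noncomputable def one : WeightedPullbackSpace n lam ρ :=
  ⟨fun _ => 1, ⟨fun _ => 1, differentiableOn_const 1, fun _ => rfl⟩, BergmanSpace.ofPoly ρ,
    fun z => by rw [BergmanSpace.ofPoly_apply, mul_one]⟩

theorem liftₗᵢ_one (z : polydisc n) : liftₗᵢ n lam ρ (one n lam ρ) z = MvPolynomial.eval z.1 ρ := by
  rw [liftₗᵢ_apply]
  exact mul_one _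

end WeightedPullbackSpace

section
variable {n : ℕ} {lam : ℝ} [Fact (0 < lam)]

theorem toSymm_permPolydisc (σ : Equiv.Perm (Fin n)) (z : polydisc n) :
    toSymm (permPolydisc σ z) = toSymm z :=
  Subtype.ext (funext fun k =>
    eval_permPolydisc ⟨MvPolynomial.esymm (Fin n) ℂ (k + 1), MvPolynomial.esymm_isSymmetric _ _ _⟩ σ z)

theorem lift_mem_symPart (g : PullbackSpace n lam) :
    WeightedPullbackSpace.liftₗᵢ n lam 1 g ∈ symPart n lam := by
  intro σ z
  rw [WeightedPullbackSpace.liftₗᵢ_apply, WeightedPullbackSpace.liftₗᵢ_apply, toSymm_permPolydisc]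
  simp

theorem eval_jacobianWeight (z : Fin n → ℂ) : MvPolynomial.eval z (jacobianWeight n) =
    ((1 / √(n.factorial : ℝ) : ℝ) : ℂ) * MvPolynomial.eval z (jacobian n) := by
  rw [jacobianWeight, map_mul, MvPolynomial.eval_C]

theorem lift_mem_antiPart (g : SymmetrizedBergmanSpace n lam) :
    WeightedPullbackSpace.liftₗᵢ n lam (jacobianWeight n) g ∈ antiPart n lam := by
  intro σ z
  rw [WeightedPullbackSpace.liftₗᵢ_apply, WeightedPullbackSpace.liftₗᵢ_apply, toSymm_permPolydisc,
    eval_jacobianWeight, eval_jacobianWeight, eval_jacobian_permPolydisc]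
  ring

variable (n lam) in
theorem not_unitarilyEquivalent_sym_anti (hn : 2 ≤ n) :
    ¬ UnitarilyEquivalent (symAction n lam) (antiAction n lam) := by
  intro h
  refine not_unitarilyEquivalent_of_antiPart (lam := lam) hn
    (antiPart n lam).subtypeₗᵢ (fun p x z => mulAction_apply _ _ p x z) (fun x => x.2)
    (v := ⟨BergmanSpace.ofPoly (jacobian n), fun σ z => by
      rw [BergmanSpace.ofPoly_apply, BergmanSpace.ofPoly_apply, eval_jacobian_permPolydisc]⟩)
    one_ne_zero (fun z => ?_)
    (symPart n lam).subtypeₗᵢ (fun p x z => mulAction_apply _ _ p x z) (fun x => x.2)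
    (y₁ := ⟨BergmanSpace.ofPoly 1, fun σ z => by simp [BergmanSpace.ofPoly_apply]⟩)
    (fun z => ?_) h.symm
  · exact (BergmanSpace.ofPoly_apply _ _).trans (one_mul _).symm
  · exact (BergmanSpace.ofPoly_apply _ _).trans (map_one _)

variable (n lam) in
theorem not_unitarilyEquivalent_symmetrizedBergman_pullback (hn : 2 ≤ n) :
    ¬ UnitarilyEquivalent (symmetrizedBergmanAction n lam) (pullbackAction n lam) :=
  not_unitarilyEquivalent_of_antiPart (lam := lam) hn
    (WeightedPullbackSpace.liftₗᵢ n lam (jacobianWeight n)) WeightedPullbackSpace.liftₗᵢ_action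
    lift_mem_antiPart (v := WeightedPullbackSpace.one n lam (jacobianWeight n))
    (c := ((1 / √(n.factorial : ℝ) : ℝ) : ℂ))
    (by rw [Ne, Complex.ofReal_eq_zero]; positivity)
    (fun z => by rw [WeightedPullbackSpace.liftₗᵢ_one, eval_jacobianWeight])
    (WeightedPullbackSpace.liftₗᵢ n lam 1) WeightedPullbackSpace.liftₗᵢ_action
    lift_mem_symPart (y₁ := WeightedPullbackSpace.one n lam 1)
    (fun z => by rw [WeightedPullbackSpace.liftₗᵢ_one, map_one])

end

/-! ### Moments of the weight of the disc -/

section moments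
open MeasureTheory

/-- The radial integral `∫₀¹ y^(2k+1) (1 - y²)^(μ-2) dy`. -/
noncomputable def radialMoment (mu : ℝ) (k : ℕ) : ℝ :=
  ∫ y in (0 : ℝ)..1, y ^ (2 * k + 1) * (1 - y ^ 2) ^ (mu - 2)

theorem hasDerivAt_one_sub_sq_rpow (a : ℝ) {y : ℝ} (hy : y ∈ Set.Ioo (0 : ℝ) 1) :
    HasDerivAt (fun y : ℝ => (1 - y ^ 2) ^ a) (-(2 * a * (y * (1 - y ^ 2) ^ (a - 1)))) y := by
  have h1 : 0 < 1 - y ^ 2 := by nlinarith [hy.1, hy.2]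
  have h2 : HasDerivAt (fun y : ℝ => 1 - y ^ 2) (-(2 * y)) y := by
    simpa using (hasDerivAt_pow 2 y).const_sub 1
  convert h2.rpow_const (p := a) (Or.inl h1.ne') using 1
  ring

theorem continuous_one_sub_sq_rpow {a : ℝ} (ha : 0 < a) :
    Continuous fun y : ℝ => (1 - y ^ 2) ^ a :=
  Continuous.rpow_const (by fun_prop) fun _ => Or.inr ha.le

theorem intervalIntegrable_radial {mu : ℝ} (hmu : 1 < mu) (k : ℕ) :
    IntervalIntegrable (fun y : ℝ => y ^ (2 * k + 1) * (1 - y ^ 2) ^ (mu - 2)) volume 0 1 := by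
  have h1 : IntervalIntegrable (fun y : ℝ => 2 * (mu - 1) * (y * (1 - y ^ 2) ^ (mu - 1 - 1)))
      volume 0 1 := by
    refine intervalIntegral.intervalIntegrable_deriv_of_nonneg
      (g := fun y : ℝ => -(1 - y ^ 2) ^ (mu - 1)) ?_ ?_ ?_
    · exact (continuous_one_sub_sq_rpow (by linarith)).neg.continuousOn
    · intro y hy
      rw [min_eq_left zero_le_one, max_eq_right zero_le_one] at hy
      exact (hasDerivAt_one_sub_sq_rpow (mu - 1) hy).neg.congr_deriv (neg_neg _)
    · intro y hy
      rw [min_eq_left zero_le_one, max_eq_right zero_le_one] at hy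
      have h2 : 0 < 1 - y ^ 2 := by nlinarith [hy.1, hy.2]
      have h3 : 0 < mu - 1 := by linarith
      have := hy.1
      positivity
  have h2 := h1.continuousOn_mul
    (g := fun y : ℝ => (2 * (mu - 1))⁻¹ * y ^ (2 * k)) (by fun_prop)
  refine h2.congr fun y _ => ?_
  have h3 : mu - 1 ≠ 0 := by linarith
  have h4 : mu - 1 - 1 = mu - 2 := by ring
  simp only [h4]
  field_simp
  ring

theorem radialMoment_pos {mu : ℝ} (hmu : 1 < mu) (k : ℕ) : 0 < radialMoment mu k := by
  refine intervalIntegral.intervalIntegral_pos_of_pos_on (intervalIntegrable_radial hmu k) ?_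
    one_pos
  intro y hy
  have h2 : 0 < 1 - y ^ 2 := by nlinarith [hy.1, hy.2]
  have := hy.1
  positivity

theorem radialMoment_succ {mu : ℝ} (hmu : 1 < mu) (k : ℕ) :
    (mu + k) * radialMoment mu (k + 1) = (k + 1) * radialMoment mu k := by
  -- Integrate the derivative of `y^(2k+2) (1 - y²)^(μ-1)`, which vanishes at both ends.
  have h1 := intervalIntegral.integral_eq_sub_of_hasDerivAt_of_le zero_le_one
    (f := fun y : ℝ => y ^ (2 * k + 2) * (1 - y ^ 2) ^ (mu - 1))
    (f' := fun y : ℝ => 2 * (k + 1) * (y ^ (2 * k + 1) * (1 - y ^ 2) ^ (mu - 2)) -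
      2 * (mu + k) * (y ^ (2 * (k + 1) + 1) * (1 - y ^ 2) ^ (mu - 2)))
    ((continuous_pow _).mul (continuous_one_sub_sq_rpow (by linarith))).continuousOn ?_
    (((intervalIntegrable_radial hmu k).const_mul _).sub
      ((intervalIntegrable_radial hmu (k + 1)).const_mul _))
  · rw [intervalIntegral.integral_sub ((intervalIntegrable_radial hmu k).const_mul _)
      ((intervalIntegrable_radial hmu (k + 1)).const_mul _),
      intervalIntegral.integral_const_mul, intervalIntegral.integral_const_mul,
      ← radialMoment, ← radialMoment] at h1
    have h3 : mu - 1 ≠ 0 := by linarith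
    simp [h3] at h1
    linarith
  · intro y hy
    have h2 : 0 < 1 - y ^ 2 := by nlinarith [hy.1, hy.2]
    have h3 : (1 - y ^ 2) ^ (mu - 1) = (1 - y ^ 2) * (1 - y ^ 2) ^ (mu - 2) := by
      rw [← Real.rpow_one_add' h2.le (by linarith)]
      congr 1; ring
    refine ((hasDerivAt_pow (2 * k + 2) y).mul
      (hasDerivAt_one_sub_sq_rpow (mu - 1) hy)).congr_deriv ?_
    have h4 : mu - 1 - 1 = mu - 2 := by ring
    rw [h3, h4, show 2 * k + 2 - 1 = 2 * k + 1 from rfl]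
    push_cast
    ring

/-- The radial profile of the weight of the disc, extended by zero. -/
noncomputable def discProfile (mu y : ℝ) : ℝ :=
  if y < 1 then (mu - 1) / Real.pi * (1 - y ^ 2) ^ (mu - 2) else 0

theorem discProfile_nonneg {mu : ℝ} (hmu : 1 < mu) {y : ℝ} (hy : 0 ≤ y) :
    0 ≤ discProfile mu y := by
  rw [discProfile]
  split_ifs with h
  · have h2 : 0 < 1 - y ^ 2 := by nlinarith
    have h3 : 0 < mu - 1 := by linarith
    positivity
  · exact le_rfl

theorem measurable_discProfile (mu : ℝ) : Measurable (discProfile mu) :=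
  Measurable.ite measurableSet_Iio (by fun_prop) measurable_const

theorem indicator_radial (mu : ℝ) (k : ℕ) :
    Set.EqOn (fun y : ℝ => y ^ (Module.finrank ℝ ℂ - 1) • (y ^ (2 * k) * discProfile mu y))
      ((Set.Ioo (0 : ℝ) 1).indicator fun y =>
        (mu - 1) / Real.pi * (y ^ (2 * k + 1) * (1 - y ^ 2) ^ (mu - 2))) (Set.Ioi 0) := by
  intro y hy
  simp only [Complex.finrank_real_complex, discProfile, smul_eq_mul]
  by_cases h : y < 1
  · rw [Set.indicator_of_mem (Set.mem_Ioo.2 ⟨hy, h⟩), if_pos h]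
    ring
  · rw [Set.indicator_of_notMem (fun h' => h h'.2), if_neg h]
    simp

theorem integrable_discProfile {mu : ℝ} (hmu : 1 < mu) (k : ℕ) :
    Integrable fun z : ℂ => ‖z‖ ^ (2 * k) * discProfile mu ‖z‖ := by
  rw [integrable_fun_norm_addHaar volume (f := fun y => y ^ (2 * k) * discProfile mu y),
    integrableOn_congr_fun (indicator_radial mu k) measurableSet_Ioi]
  refine IntegrableOn.integrable_indicator ?_ measurableSet_Ioo |>.integrableOn
  have := ((intervalIntegrable_radial hmu k).const_mul ((mu - 1) / Real.pi))
  rw [intervalIntegrable_iff_integrableOn_Ioo_of_le zero_le_one] at this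
  exact this

/-- The integrals `∫ |z|^(2k) dV^(μ)(z)` over the disc. -/
noncomputable def discMoment (mu : ℝ) (k : ℕ) : ℝ :=
  ∫ z : ℂ, ‖z‖ ^ (2 * k) * discProfile mu ‖z‖

theorem exists_discMoment_eq {mu : ℝ} (hmu : 1 < mu) :
    ∃ C : ℝ, 0 < C ∧ ∀ k, discMoment mu k = C * radialMoment mu k := by
  refine ⟨2 * (volume.real (Metric.ball (0 : ℂ) 1) * ((mu - 1) / Real.pi)), ?_, fun k => ?_⟩
  · have h1 : 0 < volume.real (Metric.ball (0 : ℂ) 1) :=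
      ENNReal.toReal_pos (Metric.measure_ball_pos volume _ one_pos).ne' measure_ball_lt_top.ne
    have h3 : 0 < mu - 1 := by linarith
    positivity
  · rw [discMoment, integral_fun_norm_addHaar volume (fun y => y ^ (2 * k) * discProfile mu y),
      setIntegral_congr_fun measurableSet_Ioi (indicator_radial mu k),
      setIntegral_indicator measurableSet_Ioo, Set.inter_eq_right.2 Set.Ioo_subset_Ioi_self,
      integral_const_mul, ← integral_Ioc_eq_integral_Ioo, ← intervalIntegral.integral_of_le
      zero_le_one, ← radialMoment, Complex.finrank_real_complex]
    simp only [smul_eq_mul, nsmul_eq_mul]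
    push_cast
    ring

theorem discMoment_pos {mu : ℝ} (hmu : 1 < mu) (k : ℕ) : 0 < discMoment mu k := by
  obtain ⟨C, hC, h⟩ := exists_discMoment_eq hmu
  rw [h]
  exact mul_pos hC (radialMoment_pos hmu k)

theorem discMoment_succ {mu : ℝ} (hmu : 1 < mu) (k : ℕ) :
    (mu + k) * discMoment mu (k + 1) = (k + 1) * discMoment mu k := by
  obtain ⟨C, -, h⟩ := exists_discMoment_eq hmu
  rw [h, h]
  linear_combination C * radialMoment_succ hmu k

theorem integral_pow_mul_conj_pow (mu : ℝ) (j k : ℕ) :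
    ∫ z : ℂ, (discProfile mu ‖z‖ : ℂ) * (conj z ^ j * z ^ k) =
      if j = k then (discMoment mu k : ℂ) else 0 := by
  split_ifs with h
  · subst h
    rw [discMoment, ← integral_complex_ofReal]
    congr 1
    funext z
    rw [← mul_pow, Complex.conj_mul']
    push_cast
    ring
  · -- A rotation by the angle `π / (k - j)` changes the sign of the integrand.
    have hne : ((k : ℝ) - j : ℂ) ≠ 0 := by
      rw [sub_ne_zero]; exact_mod_cast (Ne.symm h)
    let a : Circle := Circle.exp (Real.pi / ((k : ℝ) - j))
    have ha : conj (a : ℂ) ^ j * (a : ℂ) ^ k = -1 := by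
      rw [← Circle.coe_inv_eq_conj, Circle.coe_exp, Circle.coe_inv, Circle.coe_exp,
        ← Complex.exp_neg, ← Complex.exp_nat_mul, ← Complex.exp_nat_mul, ← Complex.exp_add,
        ← Complex.exp_pi_mul_I]
      congr 1
      push_cast at hne ⊢
      field_simp
      ring
    have h1 := (rotation a).measurePreserving.integral_comp
      (rotation a).toHomeomorph.measurableEmbedding
      (fun z : ℂ => (discProfile mu ‖z‖ : ℂ) * (conj z ^ j * z ^ k))
    have h2 : ∀ z : ℂ, (discProfile mu ‖rotation a z‖ : ℂ) *
        (conj (rotation a z) ^ j * rotation a z ^ k) =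
        -((discProfile mu ‖z‖ : ℂ) * (conj z ^ j * z ^ k)) := by
      intro z
      rw [LinearIsometryEquiv.norm_map, rotation_apply, map_mul, mul_pow, mul_pow]
      linear_combination (discProfile mu ‖z‖ : ℂ) * (conj z ^ j * z ^ k) * ha
    simp only [h2, integral_neg] at h1
    linear_combination -h1 / 2

end moments

/-! ### Integration over the polydisc and the symmetrized polydisc -/

section polydiscMeasure
open MeasureTheory
variable {n : ℕ} {mu : ℝ}

theorem prod_discProfile_nonneg (hmu : 1 < mu) (z : Fin n → ℂ) : 0 ≤ ∏ i, discProfile mu ‖z i‖ :=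
  Finset.prod_nonneg fun _ _ => discProfile_nonneg hmu (norm_nonneg _)

theorem measurable_prod_discProfile (n : ℕ) (mu : ℝ) :
    Measurable fun z : Fin n → ℂ => ∏ i, discProfile mu ‖z i‖ :=
  Finset.measurable_fun_prod _ fun i _ => (measurable_discProfile mu).comp (by fun_prop)

theorem bergmanMeasure_eq (n : ℕ) (mu : ℝ) : bergmanMeasure n mu =
    volume.withDensity fun z => ENNReal.ofReal (∏ i, discProfile mu ‖z i‖) := by
  rw [bergmanMeasure, ← withDensity_indicator (isOpen_polydisc n).measurableSet]
  congr 1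
  funext z
  by_cases hz : z ∈ polydisc n
  · rw [Set.indicator_of_mem hz]
    congr 1
    exact Finset.prod_congr rfl fun i _ => (if_pos (hz i)).symm
  · rw [Set.indicator_of_notMem hz]
    obtain ⟨i, hi⟩ : ∃ i, ¬ ‖z i‖ < 1 := by simpa [polydisc] using hz
    rw [Finset.prod_eq_zero (Finset.mem_univ i) (if_neg hi), ENNReal.ofReal_zero]

theorem integral_bergmanMeasure (hmu : 1 < mu) (φ : (Fin n → ℂ) → ℂ) :
    ∫ z, φ z ∂bergmanMeasure n mu = ∫ z, ((∏ i, discProfile mu ‖z i‖ : ℝ) : ℂ) * φ z := by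
  rw [bergmanMeasure_eq, integral_withDensity_eq_integral_toReal_smul
    (measurable_prod_discProfile n mu).ennreal_ofReal (by simp)]
  refine integral_congr_ae (.of_forall fun z => ?_)
  simp only [ENNReal.toReal_ofReal (prod_discProfile_nonneg hmu z), Complex.real_smul]

theorem isFiniteMeasure_bergmanMeasure (n : ℕ) (hmu : 1 < mu) :
    IsFiniteMeasure (bergmanMeasure n mu) := by
  rw [bergmanMeasure_eq]
  refine isFiniteMeasure_withDensity_ofReal ?_
  have h1 : Integrable fun z : ℂ => discProfile mu ‖z‖ := by
    simpa using integrable_discProfile hmu 0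
  exact (Integrable.fintype_prod (ι := Fin n) (fun _ => h1)).2

theorem ae_mem_polydisc (n : ℕ) (mu : ℝ) : ∀ᵐ z ∂bergmanMeasure n mu, z ∈ polydisc n :=
  (withDensity_absolutelyContinuous _ _).ae_le (ae_restrict_mem (isOpen_polydisc n).measurableSet)

theorem exists_ae_bound_of_continuous (n : ℕ) (mu : ℝ) {E : Type*} [NormedAddCommGroup E]
    {φ : (Fin n → ℂ) → E} (hφ : Continuous φ) :
    ∃ C, ∀ᵐ z ∂bergmanMeasure n mu, ‖φ z‖ ≤ C := by
  obtain ⟨C, hC⟩ := (isCompact_closedBall (0 : Fin n → ℂ) 1).exists_bound_of_continuousOn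
    hφ.continuousOn
  refine ⟨C, (ae_mem_polydisc n mu).mono fun z hz => hC z ?_⟩
  rw [mem_closedBall_zero_iff, pi_norm_le_iff_of_nonneg zero_le_one]
  exact fun i => (hz i).le

theorem integrable_bergmanMeasure_of_continuous (hmu : 1 < mu) {φ : (Fin n → ℂ) → ℂ}
    (hφ : Continuous φ) : Integrable φ (bergmanMeasure n mu) := by
  have := isFiniteMeasure_bergmanMeasure n hmu
  obtain ⟨C, hC⟩ := exists_ae_bound_of_continuous n mu hφ
  exact Integrable.of_bound hφ.aestronglyMeasurable C hC

theorem integral_monomial_bergmanMeasure (hmu : 1 < mu) (d e : Fin n →₀ ℕ) :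
    ∫ z, conj (∏ i, z i ^ d i) * ∏ i, z i ^ e i ∂bergmanMeasure n mu =
      if d = e then ((∏ i, discMoment mu (e i) : ℝ) : ℂ) else 0 := by
  rw [integral_bergmanMeasure hmu]
  have h1 : ∀ z : Fin n → ℂ, ((∏ i, discProfile mu ‖z i‖ : ℝ) : ℂ) *
      (conj (∏ i, z i ^ d i) * ∏ i, z i ^ e i) =
      ∏ i, (discProfile mu ‖z i‖ : ℂ) * (conj (z i) ^ d i * z i ^ e i) := fun z => by
    push_cast
    simp only [map_prod, map_pow, Finset.prod_mul_distrib]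
  simp only [h1]
  rw [integral_fintype_prod_volume_eq_prod
    (f := fun i (w : ℂ) => (discProfile mu ‖w‖ : ℂ) * (conj w ^ d i * w ^ e i))]
  simp only [integral_pow_mul_conj_pow]
  split_ifs with h
  · subst h
    simp
  · obtain ⟨i, hi⟩ : ∃ i, d i ≠ e i := by
      by_contra! h'
      exact h (Finsupp.ext h')
    exact Finset.prod_eq_zero (Finset.mem_univ i) (if_neg hi)

theorem integral_norm_eval_sq (hmu : 1 < mu) (p : MvPolynomial (Fin n) ℂ) :
    ∫ z, (‖MvPolynomial.eval z p‖ : ℂ) ^ 2 ∂bergmanMeasure n mu =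
      (diagNormSq (discMoment mu) p : ℝ) := by
  have h1 : ∀ z : Fin n → ℂ, (‖MvPolynomial.eval z p‖ : ℂ) ^ 2 =
      ∑ d ∈ p.support, ∑ e ∈ p.support, (conj (p.coeff d) * p.coeff e) *
        (conj (∏ i, z i ^ d i) * ∏ i, z i ^ e i) := fun z => by
    rw [← Complex.conj_mul', MvPolynomial.eval_eq', map_sum, Finset.sum_mul_sum]
    refine Finset.sum_congr rfl fun d _ => Finset.sum_congr rfl fun e _ => ?_
    rw [map_mul]
    ring
  have hint : ∀ (d e : Fin n →₀ ℕ) (a : ℂ), Integrable (fun z : Fin n → ℂ =>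
      a * (conj (∏ i, z i ^ d i) * ∏ i, z i ^ e i)) (bergmanMeasure n mu) := fun d e a =>
    integrable_bergmanMeasure_of_continuous hmu (by
      refine continuous_const.mul (.mul (Complex.continuous_conj.comp ?_) ?_) <;> fun_prop)
  simp only [h1]
  rw [integral_finsetSum _ fun d _ => integrable_finsetSum _ fun e _ => hint d e _, diagNormSq]
  push_cast
  refine Finset.sum_congr rfl fun d hd => ?_
  rw [integral_finsetSum _ fun e _ => hint d e _]
  simp only [integral_const_mul, integral_monomial_bergmanMeasure hmu, mul_ite, mul_zero]
  rw [Finset.sum_ite_eq, if_pos hd, Complex.conj_mul']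
  push_cast
  rfl

/-- Multiplication of all coordinates by `e^{iθ}`, as an equivalence. -/
noncomputable def rotate (n : ℕ) (θ : ℝ) : (Fin n → ℂ) ≃ᵐ (Fin n → ℂ) :=
  MeasurableEquiv.piCongrRight fun _ => (rotation (Circle.exp θ)).toHomeomorph.toMeasurableEquiv

theorem rotate_apply (θ : ℝ) (z : Fin n → ℂ) : rotate n θ z = Complex.exp (θ * Complex.I) • z :=
  rfl

theorem norm_rotate_apply (θ : ℝ) (z : Fin n → ℂ) (i : Fin n) : ‖rotate n θ z i‖ = ‖z i‖ :=
  (rotation (Circle.exp θ)).norm_map (z i)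

theorem volume_preserving_rotate (n : ℕ) (θ : ℝ) : MeasurePreserving (rotate n θ) :=
  volume_preserving_pi fun _ => (rotation (Circle.exp θ)).measurePreserving

theorem MeasureTheory.MeasurePreserving.withDensity_comp {α : Type*} [MeasurableSpace α]
    {μ : Measure α} {e : α ≃ᵐ α} (he : MeasurePreserving e μ μ) {ρ : α → ENNReal}
    (hρ : ∀ x, ρ (e x) = ρ x) : MeasurePreserving e (μ.withDensity ρ) (μ.withDensity ρ) := by
  refine ⟨e.measurable, Measure.ext fun s hs => ?_⟩
  rw [Measure.map_apply e.measurable hs, withDensity_apply _ hs,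
    withDensity_apply _ (e.measurable hs), ← he.setLIntegral_comp_preimage_emb e.measurableEmbedding ρ s]
  simp only [hρ]

/-- The measure `|J_s|² dV^(μ)` on the polydisc. -/
noncomputable def jacobianMeasure (n : ℕ) (mu : ℝ) : Measure (Fin n → ℂ) :=
  (bergmanMeasure n mu).withDensity fun z => ‖MvPolynomial.eval z (jacobian n)‖ₑ ^ 2

theorem measurePreserving_rotate (n : ℕ) (mu θ : ℝ) :
    MeasurePreserving (rotate n θ) (jacobianMeasure n mu) (jacobianMeasure n mu) := by
  refine MeasurePreserving.withDensity_comp ?_ fun z => ?_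
  · rw [bergmanMeasure_eq]
    exact (volume_preserving_rotate n θ).withDensity_comp fun z => by simp only [norm_rotate_apply]
  · have h1 : ‖MvPolynomial.eval (rotate n θ z) (jacobian n)‖ =
        ‖MvPolynomial.eval z (jacobian n)‖ := by
      simp only [jacobian, map_prod, map_sub, MvPolynomial.eval_X, norm_prod, rotate_apply,
        Pi.smul_apply, ← smul_sub, norm_smul, Complex.norm_exp_ofReal_mul_I, one_mul]
    rw [← enorm_norm, h1, enorm_norm]

theorem continuous_eval_jacobian (n : ℕ) :
    Continuous fun z : Fin n → ℂ => MvPolynomial.eval z (jacobian n) :=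
  MvPolynomial.continuous_eval _

theorem isFiniteMeasure_jacobianMeasure (n : ℕ) (hmu : 1 < mu) :
    IsFiniteMeasure (jacobianMeasure n mu) := by
  refine isFiniteMeasure_withDensity ?_
  have h1 := (integrable_bergmanMeasure_of_continuous (n := n) hmu
    ((continuous_eval_jacobian n).pow 2)).2
  simpa [HasFiniteIntegral, enorm_pow] using h1.ne

theorem integral_jacobianMeasure (φ : (Fin n → ℂ) → ℂ) : ∫ z, φ z ∂jacobianMeasure n mu =
    ∫ z, (‖MvPolynomial.eval z (jacobian n)‖ : ℂ) ^ 2 * φ z ∂bergmanMeasure n mu := by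
  rw [jacobianMeasure, integral_withDensity_eq_integral_toReal_smul
    ((continuous_eval_jacobian n).measurable.enorm.pow_const 2)
    (.of_forall fun z => ENNReal.pow_lt_top enorm_lt_top)]
  refine integral_congr_ae (.of_forall fun z => ?_)
  simp [ENNReal.toReal_pow]

theorem ae_mem_polydisc_jacobianMeasure (n : ℕ) (mu : ℝ) :
    ∀ᵐ z ∂jacobianMeasure n mu, z ∈ polydisc n :=
  (withDensity_absolutelyContinuous _ _).ae_le (ae_mem_polydisc n mu)

theorem symmBergmanMeasure_eq (n : ℕ) (mu : ℝ) : symmBergmanMeasure n mu =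
    (n.factorial : ENNReal)⁻¹ • (jacobianMeasure n mu).map (symmetrization n) := rfl

theorem isFiniteMeasure_symmBergmanMeasure (n : ℕ) (hmu : 1 < mu) :
    IsFiniteMeasure (symmBergmanMeasure n mu) := by
  have := isFiniteMeasure_jacobianMeasure n hmu
  rw [symmBergmanMeasure_eq]
  exact Measure.smul_finite _ (ENNReal.inv_ne_top.2 (by simp [Nat.factorial_ne_zero]))

theorem integral_symmBergmanMeasure {φ : (Fin n → ℂ) → ℂ} (hφ : StronglyMeasurable φ) :
    ∫ u, φ u ∂symmBergmanMeasure n mu =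
      (n.factorial : ℂ)⁻¹ * ∫ z, φ (symmetrization n z) ∂jacobianMeasure n mu := by
  rw [symmBergmanMeasure_eq, integral_smul_measure,
    integral_map (continuous_symmetrization n).aemeasurable hφ.aestronglyMeasurable]
  simp [Complex.real_smul]

/-- A function whose averages over the circles `{e^{iθ} z}` vanish has integral zero. -/
theorem integral_eq_zero_of_circle_integral_eq_zero {ν : Measure (Fin n → ℂ)} [IsFiniteMeasure ν]
    (hν : ∀ θ, MeasurePreserving (rotate n θ) ν ν) {Φ : (Fin n → ℂ) → ℂ} (hm : Measurable Φ)
    (hi : Integrable Φ ν)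
    (h0 : ∀ᵐ z ∂ν, ∫ θ in (0 : ℝ)..2 * Real.pi, Φ (rotate n θ z) = 0) : ∫ z, Φ z ∂ν = 0 := by
  have hmeas : Measurable fun x : ℝ × (Fin n → ℂ) => Φ (rotate n x.1 x.2) := by
    simp only [rotate_apply]
    exact hm.comp (by fun_prop)
  have hprod : Integrable (Function.uncurry fun (θ : ℝ) z => Φ (rotate n θ z))
      ((volume.restrict (Set.Ioc 0 (2 * Real.pi))).prod ν) := by
    refine (integrable_prod_iff hmeas.aestronglyMeasurable).2 ⟨.of_forall fun θ => ?_, ?_⟩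
    · exact (hν θ).integrable_comp_of_integrable hi
    · refine (integrable_const (∫ z, ‖Φ z‖ ∂ν)).congr (.of_forall fun θ => ?_)
      exact ((hν θ).integral_comp (rotate n θ).measurableEmbedding (fun z => ‖Φ z‖)).symm
  have h1 := integral_integral_swap hprod
  have h2 : ∀ θ, ∫ z, Φ (rotate n θ z) ∂ν = ∫ z, Φ z ∂ν := fun θ =>
    (hν θ).integral_comp (rotate n θ).measurableEmbedding Φ
  simp only [h2] at h1
  have h3 : ∀ᵐ z ∂ν, ∫ θ in Set.Ioc 0 (2 * Real.pi), Φ (rotate n θ z) = 0 := h0.mono fun z hz => by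
    rwa [intervalIntegral.integral_of_le (by positivity)] at hz
  rw [integral_eq_zero_of_ae (f := fun z => ∫ θ in Set.Ioc 0 (2 * Real.pi), Φ (rotate n θ z)) h3]
    at h1
  simpa [Real.pi_ne_zero, Real.pi_pos.le] using h1

end polydiscMeasure

/-! ### The square integrable holomorphic functions -/

section squareIntegrable
open MeasureTheory
variable {n : ℕ} {mu : ℝ}

theorem symmetrization_mem {z : Fin n → ℂ} (hz : z ∈ polydisc n) :
    symmetrization n z ∈ symmetrizedPolydisc n := ⟨z, hz, rfl⟩

theorem differentiable_symmetrization (n : ℕ) : Differentiable ℂ (symmetrization n) :=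
  differentiable_pi.2 fun k => by
    have h : ∀ q : MvPolynomial (Fin n) ℂ, Differentiable ℂ fun u => MvPolynomial.eval u q := by
      intro q
      induction q using MvPolynomial.induction_on with
      | C c => simp
      | add p q hp hq => simp only [map_add]; exact hp.add hq
      | mul_X p i hp =>
        simp only [map_mul, MvPolynomial.eval_X]
        exact hp.mul (differentiable_apply i)
    exact h _

/-- The mean value property on the analytic disc `t ↦ s(t z)`. -/
theorem circle_integral_comp_symmetrization {H : (Fin n → ℂ) → ℂ}
    (hH : DifferentiableOn ℂ H (symmetrizedPolydisc n)) (h0 : H (symmetrization n 0) = 0)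
    {z : Fin n → ℂ} (hz : z ∈ polydisc n) :
    ∫ θ in (0 : ℝ)..2 * Real.pi, H (symmetrization n (rotate n θ z)) = 0 := by
  let ψ : ℂ → ℂ := fun t => H (symmetrization n (t • z))
  have hmem : ∀ t : ℂ, ‖t‖ ≤ 1 → t • z ∈ polydisc n := fun t ht i => by
    rw [Pi.smul_apply, norm_smul]
    exact (mul_le_of_le_one_left (norm_nonneg _) ht).trans_lt (hz i)
  have hd : DifferentiableOn ℂ ψ (closure (Metric.ball 0 |1|)) := by
    refine hH.comp ((differentiable_symmetrization n).comp
      (differentiable_id.smul_const z)).differentiableOn fun t ht => ?_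
    rw [abs_one, closure_ball _ one_ne_zero, mem_closedBall_zero_iff] at ht
    exact symmetrization_mem (hmem t ht)
  have h1 := hd.diffContOnCl.circleAverage
  have h2 : ψ 0 = 0 := by simpa [ψ] using h0
  rw [h2, Real.circleAverage_def] at h1
  have h3 := (smul_eq_zero.1 h1).resolve_left (by positivity)
  rw [← h3]
  refine intervalIntegral.integral_congr fun θ _ => ?_
  simp [ψ, circleMap, rotate_apply]

theorem integral_jacobianMeasure_comp_symmetrization (hmu : 1 < mu) {H : (Fin n → ℂ) → ℂ}
    (hH : DifferentiableOn ℂ H (symmetrizedPolydisc n)) (h0 : H (symmetrization n 0) = 0)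
    (hi : Integrable (fun z => H (symmetrization n z)) (jacobianMeasure n mu)) :
    ∫ z, H (symmetrization n z) ∂jacobianMeasure n mu = 0 := by
  have := isFiniteMeasure_jacobianMeasure n hmu
  let Φ : (Fin n → ℂ) → ℂ := (polydisc n).indicator fun z => H (symmetrization n z)
  have hΦ : (fun z => H (symmetrization n z)) =ᵐ[jacobianMeasure n mu] Φ :=
    (ae_mem_polydisc_jacobianMeasure n mu).mono fun z hz => 
      (Set.indicator_of_mem (f := fun z => H (symmetrization n z)) hz).symm
  have hcont : ContinuousOn (fun z => H (symmetrization n z)) (polydisc n) :=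
    hH.continuousOn.comp (continuous_symmetrization n).continuousOn fun z hz => symmetrization_mem hz
  have hmeas : Measurable Φ := by
    classical
    have := hcont.measurable_piecewise (g := 0) continuousOn_const
      (isOpen_polydisc n).measurableSet
    rwa [Set.piecewise_eq_indicator] at this
  rw [integral_congr_ae hΦ]
  refine integral_eq_zero_of_circle_integral_eq_zero (measurePreserving_rotate n mu) hmeas
    (hi.congr hΦ) ((ae_mem_polydisc_jacobianMeasure n mu).mono fun z hz => ?_)
  rw [← circle_integral_comp_symmetrization hH h0 hz]
  refine intervalIntegral.integral_congr fun θ _ => Set.indicator_of_mem (fun i => ?_) _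
  rw [norm_rotate_apply]
  exact hz i

theorem ae_comp_symmetrization {P : (Fin n → ℂ) → Prop}
    (h : ∀ᵐ u ∂symmBergmanMeasure n mu, P u) :
    ∀ᵐ z ∂jacobianMeasure n mu, P (symmetrization n z) := by
  rw [symmBergmanMeasure_eq,
    Measure.ae_ennreal_smul_measure_iff (ENNReal.inv_ne_zero.2 (ENNReal.natCast_ne_top _))] at h
  exact ae_of_ae_map (continuous_symmetrization n).aemeasurable h

theorem integrable_comp_symmetrization {φ : (Fin n → ℂ) → ℂ}
    (h : Integrable φ (symmBergmanMeasure n mu)) :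
    Integrable (fun z => φ (symmetrization n z)) (jacobianMeasure n mu) := by
  rw [symmBergmanMeasure_eq, integrable_smul_measure
    (ENNReal.inv_ne_zero.2 (ENNReal.natCast_ne_top _))
    (ENNReal.inv_ne_top.2 (by simp [Nat.factorial_ne_zero]))] at h
  exact h.comp_aemeasurable (continuous_symmetrization n).aemeasurable

theorem symmValue_one (u : Fin n → ℂ) : symmValue (1 : SymPoly n) u = 1 := by
  simp [symmValue]

/-- The constant function `1` in the Bergman space of `𝔾ₙ`. -/
theorem exists_one (n : ℕ) (hmu : 1 < mu) : ∃ v : squareIntegrableBergman n mu,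
    v.1 =ᵐ[symmBergmanMeasure n mu] symmValue (1 : SymPoly n) := by
  have := isFiniteMeasure_symmBergmanMeasure n hmu
  have h := (memLp_const (μ := symmBergmanMeasure n mu) (p := 2) (1 : ℂ)).coeFn_toLp
  refine ⟨⟨_, fun _ => 1, differentiableOn_const 1, h⟩, ?_⟩
  filter_upwards [h] with u hu
  rw [symmValue_one]
  exact hu

theorem norm_sq_of_ae_eq_symmValue (hmu : 1 < mu) {F : squareIntegrableBergman n mu} {p : SymPoly n}
    (hF : F.1 =ᵐ[symmBergmanMeasure n mu] symmValue p) :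
    ‖F‖ ^ 2 = (n.factorial : ℝ)⁻¹ * diagNormSq (discMoment mu) (p.1 * jacobian n) := by
  have h1 : ⟪F.1, F.1⟫_ℂ = ∫ u, (‖symmValue p u‖ : ℂ) ^ 2 ∂symmBergmanMeasure n mu := by
    rw [L2.inner_def]
    refine integral_congr_ae (hF.mono fun u hu => ?_)
    simp only [hu]
    exact inner_self_eq_norm_sq_to_K _
  have h2 : Continuous fun u : Fin n → ℂ => (‖symmValue p u‖ : ℂ) ^ 2 :=
    (Complex.continuous_ofReal.comp (differentiable_symmValue p).continuous.norm).pow 2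
  rw [integral_symmBergmanMeasure h2.stronglyMeasurable, integral_jacobianMeasure,
    inner_self_eq_norm_sq_to_K] at h1
  simp only [symmValue_symmetrization, ← mul_pow, ← Complex.ofReal_mul, ← norm_mul, ← map_mul] at h1
  rw [mul_comm (jacobian n), integral_norm_eval_sq hmu] at h1
  apply Complex.ofReal_injective
  push_cast
  exact h1

/-- The constant `1` is orthogonal to the multiples of all functions in the Bergman space of `𝔾ₙ` by
symmetric polynomials without constant term. -/
theorem inner_one_eq_zero (hmu : 1 < mu) {v : squareIntegrableBergman n mu}
    (hv : v.1 =ᵐ[symmBergmanMeasure n mu] symmValue (1 : SymPoly n)) {p : SymPoly n}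
    (hp : MvPolynomial.constantCoeff p.1 = 0) (F : squareIntegrableBergman n mu) :
    ⟪v, squareIntegrableBergmanAction n mu p F⟫_ℂ = 0 := by
  have := isFiniteMeasure_symmBergmanMeasure n hmu
  obtain ⟨G, hG, hF⟩ := F.2
  have hT := squareIntegrableBergmanAction_apply n mu p F
  set Ψ := (squareIntegrableBergmanAction n mu p F).1 with hΨ
  have h1 : ⟪v, squareIntegrableBergmanAction n mu p F⟫_ℂ = ∫ u, Ψ u ∂symmBergmanMeasure n mu := by
    change ⟪v.1, Ψ⟫_ℂ = _
    rw [L2.inner_def]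
    refine integral_congr_ae (hv.mono fun u hu => ?_)
    simp only [hu, symmValue_one]
    simp
  have h2 : Integrable Ψ (symmBergmanMeasure n mu) := (Lp.memLp Ψ).integrable one_le_two
  have h3 : (fun z => symmValue p (symmetrization n z) * G (symmetrization n z))
      =ᵐ[jacobianMeasure n mu] fun z => Ψ (symmetrization n z) := by
    have h4 : Ψ =ᵐ[symmBergmanMeasure n mu] fun u => symmValue p u * G u := by
      filter_upwards [hT, hF] with u hu1 hu2
      rw [hu1, hu2]
    exact (ae_comp_symmetrization h4).mono fun z hz => hz.symm
  have h5 := integrable_comp_symmetrization h2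
  rw [h1, integral_symmBergmanMeasure (Lp.stronglyMeasurable Ψ), ← integral_congr_ae h3,
    integral_jacobianMeasure_comp_symmetrization hmu (H := fun u => symmValue p u * G u)
      ((differentiable_symmValue p).differentiableOn.mul hG) ?_ (h5.congr h3.symm), mul_zero]
  rw [symmValue_symmetrization, MvPolynomial.eval_zero, hp, zero_mul]

theorem not_unitarilyEquivalent_squareIntegrableBergman_pullback (n : ℕ) (hn : 2 ≤ n) (lam : ℝ)
    [Fact (0 < lam)] (hlam : 1 < lam) :
    ¬ UnitarilyEquivalent (squareIntegrableBergmanAction n lam) (pullbackAction n lam) := by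
  obtain ⟨v, hv⟩ := exists_one n hlam
  obtain ⟨ε, hε, hJ⟩ := exists_jacobian_eq n
  have hfac : (0 : ℝ) < (n.factorial : ℝ) := by positivity
  have hε' : 0 < ‖ε‖ := norm_pos_iff.2 hε
  have hv2 := norm_sq_of_ae_eq_symmValue hlam hv
  have hTv : (squareIntegrableBergmanAction n lam (sumX n) v).1 =ᵐ[symmBergmanMeasure n lam]
      symmValue (sumX n) := by
    filter_upwards [squareIntegrableBergmanAction_apply n lam (sumX n) v, hv] with u h1 h2
    rw [h1, h2, symmValue_one, mul_one]
  have he2 := norm_sq_of_ae_eq_symmValue hlam hTv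
  rw [OneMemClass.coe_one, one_mul, hJ, diagNormSq_C_mul] at hv2
  rw [hJ, mul_left_comm, diagNormSq_C_mul, sumX] at he2
  refine not_unitarilyEquivalent_of_orthogonal (lam := lam) hn (v := v) ?_
    (fun p F hp => inner_one_eq_zero hlam hv hp F) ?_
    (WeightedPullbackSpace.liftₗᵢ n lam 1) WeightedPullbackSpace.liftₗᵢ_action
    lift_mem_symPart (y₁ := WeightedPullbackSpace.one n lam 1)
    (fun z => by rw [WeightedPullbackSpace.liftₗᵢ_one, map_one])
  · rintro rfl
    rw [diagNormSq_alternant _ _ Fin.val_injective, norm_zero] at hv2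
    have h1 : 0 < ∏ i : Fin n, discMoment lam i := Finset.prod_pos fun i _ => discMoment_pos hlam _
    have h2 : 0 < (n.factorial : ℝ)⁻¹ *
        (‖ε‖ ^ 2 * (n.factorial * ∏ i : Fin n, discMoment lam i)) := by positivity
    rw [← hv2] at h2
    norm_num at h2
  · have h1 := diagNormSq_sum_X_mul_alternant (n := n) (by omega) lam (discMoment lam)
      (discMoment_succ hlam)
    rw [hv2, sumX, he2]
    linear_combination (n.factorial : ℝ)⁻¹ * ‖ε‖ ^ 2 * h1

end squareIntegrable

theorem theorem4p5 (n : ℕ) (hn : 2 ≤ n) (lam : ℝ) [Fact (0 < lam)] :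
    ¬ UnitarilyEquivalent (symAction n lam) (antiAction n lam) ∧
    ¬ UnitarilyEquivalent (symmetrizedBergmanAction n lam) (pullbackAction n lam) ∧
    (1 < lam →
      ¬ UnitarilyEquivalent (squareIntegrableBergmanAction n lam) (pullbackAction n lam)) :=
  ⟨not_unitarilyEquivalent_sym_anti n lam hn,
    not_unitarilyEquivalent_symmetrizedBergman_pullback n lam hn,
    not_unitarilyEquivalent_squareIntegrableBergman_pullback n hn lam⟩
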